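/- Call a subset of a finite-dimensional real inner product space $V$ a \emph{convex cone} if it is the set of all nonnegative linear combinations of some finite set of vectors, a \emph{conical simplex} if these vectors can be chosen linearly independent, and a \emph{cone} if it is a finite (possibly empty) union of convex cones. Let $L_n$ be the abelian group with a generator $\langle P\rangle_n$ for each cone $P\subset\mathbb R^n$ and relations $\langle P\cup Q\rangle_n=\langle P\rangle_n+\langle Q\rangle_n-\langle P\cap Q\rangle_n$, $\langle\emptyset\rangle_n=0$, and $\langle gP\rangle_n=\langle P\rangle_n$ for every linear isometry $g$ of $\mathbb R^n$. A \emph{Euclidean cone} of dimension at most $n$ is a finite conical simplicial complex $C$ (not necessarily embedded in a Euclidean space) whose conical simplices $\sigma$ are equipped with linear embeddings $\sigma\to\mathbb R^n$, given up to isometry and compatible, up to isometry, with restriction to faces. Its class is $\langle C\rangle_n=\sum_\sigma\left(\langle\sigma\rangle_n-\langle\partial\sigma\rangle_n\right)\in L_n$, where $\sigma$ runs over the conical simplices of $C$, including the apex (with $\partial\sigma=\emptyset$ for the apex), and each $\sigma$ is regarded as a cone in $\mathbb R^n$ through its embedding. Call $C$ an \emph{interior manifold cone} of dimension $m$ if it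 is nonempty and its underlying PL space is an $m$-dimensional PL manifold with empty boundary. Let $L_n^{ev}$ and $L_n^{od}$ be the subgroups of $L_n$ generated by the classes $\langle C\rangle_n$ of the interior manifold cones $C$ (Euclidean cones of dimension at most $n$) of even and of odd dimension, respectively. For every $n>0$ the subgroup $L_n^{ev}+L_n^{od}\subset L_n$ has index two, and the quotient $L_n/(L_n^{ev}+L_n^{od})$ is generated by the image of the half-line element $t^{n-1}d$, that is, of the class in $L_n$ of the closed half-line $\{0\}^{n-1}\times[0,\infty)\subset\mathbb R^n$. -/

import Mathlib

open scoped Topology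

/-! ### Cones and the group `L_n` -/

/-- A convex cone: the set of all nonnegative linear combinations of a finite set of vectors
(`{0}` when the finite set is empty). -/
def IsConvexCone {E : Type*} [AddCommGroup E] [Module ℝ E] (P : Set E) : Prop :=
  ∃ s : Set E, s.Finite ∧ P = (PointedCone.hull ℝ s : Set E)

/-- A cone: a union of finitely many convex cones (the empty set is a cone). -/
def IsCone {E : Type*} [AddCommGroup E] [Module ℝ E] (P : Set E) : Prop :=
  ∃ S : Set (Set E), S.Finite ∧ (∀ C ∈ S, IsConvexCone C) ∧ P = ⋃₀ S

/-- The cones in `ℝ^n`. -/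
def ConeIn (n : ℕ) : Type := {P : Set (EuclideanSpace ℝ (Fin n)) // IsCone P}

/-- The relations that make `P ↦ (P)` a valuation of cones, invariant under linear isometries. -/
def coneRelations (n : ℕ) : Set (FreeAbelianGroup (ConeIn n)) :=
  {x | ∃ P Q U N : ConeIn n, U.1 = P.1 ∪ Q.1 ∧ N.1 = P.1 ∩ Q.1 ∧
      x = FreeAbelianGroup.of U -
        (FreeAbelianGroup.of P + FreeAbelianGroup.of Q - FreeAbelianGroup.of N)} ∪
  {x | ∃ P : ConeIn n, P.1 = ∅ ∧ x = FreeAbelianGroup.of P} ∪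
  {x | ∃ (g : EuclideanSpace ℝ (Fin n) ≃ₗᵢ[ℝ] EuclideanSpace ℝ (Fin n)) (P Q : ConeIn n),
      Q.1 = g '' P.1 ∧ x = FreeAbelianGroup.of Q - FreeAbelianGroup.of P}

/-- The group `L_n`: the target of the universal isometry-invariant valuation of cones in `ℝ^n`
(the coinvariants of the orthogonal group on the cone group of `ℝ^n`). -/
abbrev LGroup (n : ℕ) : Type :=
  FreeAbelianGroup (ConeIn n) ⧸ AddSubgroup.closure (coneRelations n)

/-- The class `⟨P⟩_n` in `L_n` of a cone `P` in `ℝ^n`. -/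
def coneClass {n : ℕ} (P : Set (EuclideanSpace ℝ (Fin n))) (hP : IsCone P) : LGroup n :=
  QuotientAddGroup.mk (FreeAbelianGroup.of (⟨P, hP⟩ : ConeIn n))

theorem isCone_hull {E : Type*} [AddCommGroup E] [Module ℝ E] {s : Set E} (hs : s.Finite) :
    IsCone (PointedCone.hull ℝ s : Set E) :=
  ⟨{(PointedCone.hull ℝ s : Set E)}, Set.finite_singleton _,
    fun _ hC => ⟨s, hs, hC⟩, (Set.sUnion_singleton _).symm⟩

theorem isCone_biUnion_hull {E ι : Type*} [AddCommGroup E] [Module ℝ E] (t : Finset ι)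
    (u : ι → Set E) (hu : ∀ i, (u i).Finite) :
    IsCone (⋃ i ∈ t, (PointedCone.hull ℝ (u i) : Set E)) := by
  refine ⟨(fun i => (PointedCone.hull ℝ (u i) : Set E)) '' (t : Set ι),
    t.finite_toSet.image _, ?_, ?_⟩
  · rintro _ ⟨i, _, rfl⟩
    exact ⟨u i, hu i, rfl⟩
  · simp [Set.sUnion_image]

/-- The half-line element of `L_n`, `n > 0`: the class of the closed half-line
`{0}^{n-1} × [0, ∞)` in `ℝ^n = ℝ^{n-1} × ℝ`. As the product of classes is the class of the
product and `t`, `d` are the classes of `{0}` and `[0, ∞)` in `L_1`, this is `t^{n-1} d`. -/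
noncomputable def halfLineClass (n : ℕ) (hn : 0 < n) : LGroup n :=
  coneClass (PointedCone.hull ℝ
      {(EuclideanSpace.single ⟨n - 1, Nat.sub_lt hn Nat.one_pos⟩ 1 : EuclideanSpace ℝ (Fin n))} :
      Set (EuclideanSpace ℝ (Fin n)))
    (isCone_hull (Set.finite_singleton _))

/-! ### PL manifolds -/

/-- The set `N` is a polytope, a finite union of convex hulls of finite sets, and the map `f` is
affine on each of these: `f` restricts to a PL map on the compact PL space `N`. The single-valued
`f` is continuous on `N` because the finitely many pieces are closed. -/
def IsPLOnPolytope {E F : Type*} [AddCommGroup E] [Module ℝ E] [AddCommGroup F] [Module ℝ F]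
    (f : E → F) (N : Set E) : Prop :=
  ∃ S : Set (Set E), S.Finite ∧ N = ⋃₀ S ∧
    ∀ P ∈ S, (∃ s : Set E, s.Finite ∧ P = convexHull ℝ s) ∧
      ∃ a : E →ᵃ[ℝ] F, Set.EqOn f a P

/-- `M` is an `m`-dimensional PL manifold with empty boundary: each point `x` of `M` has a
compact polyhedral neighbourhood `N` in `M` with a PL homeomorphism `f` of `N` onto a
neighbourhood of `f x` in `ℝ^m`. -/
def IsPLManifoldWithoutBoundary {k : ℕ} (m : ℕ) (M : Set (Fin k → ℝ)) : Prop :=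
  ∀ x ∈ M, ∃ N : Set (Fin k → ℝ), N ⊆ M ∧ N ∈ 𝓝[M] x ∧
    ∃ f : (Fin k → ℝ) → (Fin m → ℝ),
      IsPLOnPolytope f N ∧ Set.InjOn f N ∧ f '' N ∈ 𝓝 (f x)

/-! ### Euclidean cones in the abstract sense -/

/-- A (triangulated, abstract) Euclidean cone of dimension at most `n`. The conical simplices are
indexed by the faces of a finite simplicial complex on `Fin k`, where the empty face stands for
the apex. The simplex of a face `s` gets its Euclidean structure from a linear embedding in `ℝ^n`,
sending the edge `i ∈ s` to the ray spanned by `emb s i`; only the inner products of these vectors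
matter. The structures are compatible with restriction to faces. -/
structure EuclideanCone (n : ℕ) where
  /-- number of labels for the edges (not all of them need occur) -/
  k : ℕ
  /-- the conical simplices -/
  faces : Finset (Finset (Fin k))
  down_closed : ∀ s ∈ faces, ∀ t ⊆ s, t ∈ faces
  /-- the embeddings of the simplices -/
  emb : Finset (Fin k) → Fin k → EuclideanSpace ℝ (Fin n)
  linearIndependent : ∀ s ∈ faces, LinearIndependent ℝ (fun i : s => emb s i)
  compatible : ∀ s ∈ faces, ∀ t ⊆ s, ∀ i ∈ t, ∀ j ∈ t,
    inner ℝ (emb t i) (emb t j) = inner ℝ (emb s i) (emb s j)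

namespace EuclideanCone

variable {n : ℕ} (C : EuclideanCone n)

/-- The underlying PL space: the points with nonnegative coordinates, supported on a face. -/
def carrier : Set (Fin C.k → ℝ) :=
  {x | (∀ i, 0 ≤ x i) ∧ ∃ s ∈ C.faces, ∀ i, i ∉ s → x i = 0}

/-- The conical simplex of the face `s`, embedded in `ℝ^n`. -/
def simplex (s : Finset (Fin C.k)) : Set (EuclideanSpace ℝ (Fin n)) :=
  (PointedCone.hull ℝ (C.emb s '' (s : Set (Fin C.k))) : Set (EuclideanSpace ℝ (Fin n)))

/-- Its boundary: the union of its facets (empty when `s` is empty). -/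
def simplexBoundary (s : Finset (Fin C.k)) : Set (EuclideanSpace ℝ (Fin n)) :=
  ⋃ i ∈ s, (PointedCone.hull ℝ (C.emb s '' ((s.erase i : Finset (Fin C.k)) : Set (Fin C.k))) :
    Set (EuclideanSpace ℝ (Fin n)))

theorem isCone_simplex (s : Finset (Fin C.k)) : IsCone (C.simplex s) :=
  isCone_hull (s.finite_toSet.image _)

theorem isCone_simplexBoundary (s : Finset (Fin C.k)) : IsCone (C.simplexBoundary s) :=
  isCone_biUnion_hull s _ fun i => (s.erase i).finite_toSet.image _

/-- The class `⟨C⟩_n` in `L_n` of a Euclidean cone: `C` is the disjoint union of the interiors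
`int σ = σ - ∂σ` of its conical simplices, so its class is the sum of the `⟨σ⟩_n - ⟨∂σ⟩_n`. -/
noncomputable def toL : LGroup n :=
  ∑ s ∈ C.faces,
    (coneClass (C.simplex s) (C.isCone_simplex s) -
      coneClass (C.simplexBoundary s) (C.isCone_simplexBoundary s))

/-- `C` is an interior manifold cone of dimension `m`: a nonempty PL `m`-manifold with empty
boundary. -/
def IsInteriorManifold (m : ℕ) : Prop :=
  C.carrier.Nonempty ∧ IsPLManifoldWithoutBoundary m C.carrier

end EuclideanCone

/-- The subgroup of `L_n` generated by the even-dimensional interior manifold cones. -/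
def Lev (n : ℕ) : AddSubgroup (LGroup n) :=
  AddSubgroup.closure
    {x | ∃ (C : EuclideanCone n) (m : ℕ), Even m ∧ C.IsInteriorManifold m ∧ x = C.toL}

/-- The subgroup of `L_n` generated by the odd-dimensional interior manifold cones. -/
def Lod (n : ℕ) : AddSubgroup (LGroup n) :=
  AddSubgroup.closure
    {x | ∃ (C : EuclideanCone n) (m : ℕ), Odd m ∧ C.IsInteriorManifold m ∧ x = C.toL}

/-! Write M for `Lev n ⊔ Lod n` and d for the half-line class. That d is not in M is seen by a
parity: to a cone P assign, mod 2, its Euler characteristic with compact supports plus 1 if P is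
nonempty. Both terms are isometry-invariant valuations (the second because nonempty cones share the
origin), so this gives `parityHom`. On an abstract cone C it takes the value (number of faces) + 1,
the extra 1 coming from the apex, whose boundary is empty. The number of faces is the compactly
supported Euler characteristic of the carrier. For an interior manifold cone, a PL chart at the apex
is linear on finitely many cones near the apex, and rescaling turns it into a piecewise linear
bijection of the whole carrier with ℝ^m; hence the number of faces is odd and the parity vanishes
(`parityHom_toL_eq_zero`). The half-line consists of two cells, so its parity is 1.

That M and d generate L_n is shown by induction on the dimension of simplices, which generate L_n by
inclusion–exclusion (`exists_coneClass_mem_simplexGroup`). Two facts hold modulo simplices of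
smaller dimension. First, the cone over the boundary of the cross-polytope can be folded so that all
of its 2^k facets are copies of a given k-dimensional simplex; it is an interior manifold cone, so
2^k times the simplex lies in M (`two_pow_smul_conicClass_mem`). Second, for k ≥ 2, dissecting a
simplex from its incenter and then dissecting each piece from the foot of the perpendicular on its
facet gives pieces matched in mirror-image pairs, so the simplex is twice something
(`conicClass_mem_of_two_smul_mem`). A group that is 2-divisible and killed by a power of 2 is zero,
so dimension k ≥ 2 contributes nothing new. In dimension 0 the cross-polytope cone is the point
itself, and in dimension 1 all half-lines are congruent; thus 2d is in M and the quotient has order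
two. -/

/-! ### The Euler characteristic mod 2 of unions of sign cells -/

section SignPattern

variable {E E' : Type*} [AddCommGroup E] [Module ℝ E] [AddCommGroup E'] [Module ℝ E']

/-- The signs of the functionals in a list at a point. -/
noncomputable def signPattern (F : List (E →ₗ[ℝ] ℝ)) (x : E) : List SignType :=
  F.map fun h => SignType.sign (h x)

theorem signPattern_eq_iff {F : List (E →ₗ[ℝ] ℝ)} {x y : E} :
    signPattern F x = signPattern F y ↔ ∀ h ∈ F, SignType.sign (h x) = SignType.sign (h y) := by
  simp [signPattern]

/-- `P` is a union of cells of the arrangement `F`. -/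
def IsUnionOfCells (F : List (E →ₗ[ℝ] ℝ)) (P : Set E) : Prop :=
  ∀ x y, signPattern F x = signPattern F y → x ∈ P → y ∈ P

/-- `P` is a union of cells of some arrangement. -/
def IsConstructible (P : Set E) : Prop :=
  ∃ F : List (E →ₗ[ℝ] ℝ), IsUnionOfCells F P

/-- The number of cells of the arrangement `F` that meet `P`. -/
noncomputable def cellCount (F : List (E →ₗ[ℝ] ℝ)) (P : Set E) : ℕ :=
  (signPattern F '' P).ncard

theorem finite_signPattern_image (F : List (E →ₗ[ℝ] ℝ)) (P : Set E) :
    (signPattern F '' P).Finite := by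
  refine (List.finite_length_eq SignType F.length).subset ?_
  rintro _ ⟨x, _, rfl⟩
  simp [signPattern]

theorem ncard_image_eq_of_ker_eq {α β γ : Type*} {f : α → β} {g : α → γ} {P : Set α}
    (h : ∀ x ∈ P, ∀ y ∈ P, f x = f y ↔ g x = g y) : (f '' P).ncard = (g '' P).ncard := by
  classical
  have key : ∀ b ∈ f '' P, ∃ x ∈ P, f x = b := fun b hb => hb
  choose r hrP hr using key
  refine Set.ncard_congr (fun b hb => g (r b hb)) ?_ ?_ ?_
  · exact fun b hb => ⟨r b hb, hrP b hb, rfl⟩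
  · intro a b ha hb hab
    have := (h _ (hrP a ha) _ (hrP b hb)).2 hab
    rwa [hr a ha, hr b hb] at this
  · rintro _ ⟨x, hx, rfl⟩
    have hfx : f x ∈ f '' P := ⟨x, hx, rfl⟩
    exact ⟨f x, hfx, (h _ (hrP _ hfx) _ hx).1 (hr _ hfx)⟩

theorem IsUnionOfCells.mono {F G : List (E →ₗ[ℝ] ℝ)} {P : Set E} (h : IsUnionOfCells F P)
    (hFG : ∀ f ∈ F, f ∈ G) : IsUnionOfCells G P := fun x y hxy =>
  h x y (signPattern_eq_iff.2 fun f hf => signPattern_eq_iff.1 hxy f (hFG f hf))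

theorem sign_eventually_eq {a : ℝ → ℝ} (ha : Continuous a) {c : ℝ} {s : ℝ}
    (hc : SignType.sign (a c) = SignType.sign s) (hs : s ≠ 0) :
    ∀ᶠ t in 𝓝 c, SignType.sign (a t) = SignType.sign s := by
  rcases lt_or_gt_of_ne hs with h | h
  · rw [sign_neg h] at hc ⊢
    rw [sign_eq_neg_one_iff] at hc
    filter_upwards [ha.continuousAt.eventually (gt_mem_nhds hc)] with t ht
    exact sign_neg ht
  · rw [sign_pos h] at hc ⊢
    rw [sign_eq_one_iff] at hc
    filter_upwards [ha.continuousAt.eventually (lt_mem_nhds hc)] with t ht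
    exact sign_pos ht

/-- A functional that is not of constant sign on a cell takes all three signs there. -/
theorem exists_sign_eq_of_sign_ne {F : List (E →ₗ[ℝ] ℝ)} {h : E →ₗ[ℝ] ℝ} {x y : E}
    (hxy : signPattern F x = signPattern F y) (hne : SignType.sign (h x) ≠ SignType.sign (h y))
    (σ : SignType) : ∃ z, signPattern F z = signPattern F x ∧ SignType.sign (h z) = σ := by
  have hne' : h y - h x ≠ 0 := fun h0 => hne (by rw [sub_eq_zero.1 h0])
  -- The signs of h at the endpoints differ, so h vanishes at some point of the segment from x to y,
  -- endpoints allowed.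
  obtain ⟨t₀, h0, h1, ht₀⟩ : ∃ t₀ : ℝ, 0 ≤ t₀ ∧ t₀ ≤ 1 ∧ h x + t₀ * (h y - h x) = 0 := by
    refine ⟨-h x / (h y - h x), ?_, ?_, by field_simp; ring⟩
    · rcases lt_trichotomy (h x) 0 with hx | hx | hx
      · have : 0 ≤ h y := by
          by_contra! hy
          exact hne (by rw [sign_neg hx, sign_neg hy])
        apply div_nonneg <;> linarith
      · simp [hx]
      · have : h y ≤ 0 := by
          by_contra! hy
          exact hne (by rw [sign_pos hx, sign_pos hy])
        apply div_nonneg_of_nonpos <;> linarith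
    · rcases lt_trichotomy (h x) 0 with hx | hx | hx
      · have : 0 ≤ h y := by
          by_contra! hy
          exact hne (by rw [sign_neg hx, sign_neg hy])
        rw [div_le_one (by linarith)]
        linarith
      · simp [hx]
      · have : h y ≤ 0 := by
          by_contra! hy
          exact hne (by rw [sign_pos hx, sign_pos hy])
        rw [div_le_one_of_neg (by linarith)]
        linarith
  -- A cell is convex and relatively open, so the line through x and y stays in it slightly beyond
  -- the zero of h on either side. There h is τ times a nonzero constant and takes all three signs.
  have ev : ∀ᶠ τ in 𝓝 (0 : ℝ), ∀ f ∈ {f | f ∈ F},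
      SignType.sign (f x + (t₀ + τ) * (f y - f x)) = SignType.sign (f x) := by
    rw [Filter.eventually_all_finite (List.finite_toSet F)]
    intro f hf
    have hs := signPattern_eq_iff.1 hxy f hf
    by_cases hfx : f x = 0
    · have : f y = 0 := by
        rw [hfx, sign_zero] at hs
        exact sign_eq_zero_iff.1 hs.symm
      simp [hfx, this]
    · refine sign_eventually_eq (by fun_prop) ?_ hfx
      rcases lt_or_gt_of_ne hfx with hx | hx
      · have hy : f y < 0 := by
          rw [sign_neg hx] at hs
          exact sign_eq_neg_one_iff.1 hs.symm
        rw [sign_neg hx, sign_eq_neg_one_iff]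
        rcases le_total (f x) (f y) with hc | hc <;>
          nlinarith [mul_nonneg h0 (sub_nonneg.2 hc), mul_nonneg (sub_nonneg.2 h1) (sub_nonneg.2 hc)]
      · have hy : 0 < f y := by
          rw [sign_pos hx] at hs
          exact sign_eq_one_iff.1 hs.symm
        rw [sign_pos hx, sign_eq_one_iff]
        rcases le_total (f x) (f y) with hc | hc <;>
          nlinarith [mul_nonneg h0 (sub_nonneg.2 hc), mul_nonneg (sub_nonneg.2 h1) (sub_nonneg.2 hc)]
  obtain ⟨ε, hε, hball⟩ := Metric.eventually_nhds_iff.1 ev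
  have key : ∀ τ : ℝ, |τ| < ε → signPattern F (x + (t₀ + τ) • (y - x)) = signPattern F x ∧
      h (x + (t₀ + τ) • (y - x)) = τ * (h y - h x) := by
    intro τ hτ
    refine ⟨signPattern_eq_iff.2 fun f hf => ?_, ?_⟩
    · simpa using hball (by simpa using hτ) f hf
    · simp only [map_add, map_smul, map_sub, smul_eq_mul]
      linarith
  have hε2 : |ε / 2| < ε := by rw [abs_of_pos (by positivity)]; linarith
  have hε2' : |-(ε / 2)| < ε := by rwa [abs_neg]
  rcases lt_or_gt_of_ne hne' with hd | hd
  · cases σ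
    · exact ⟨_, (key 0 (by simpa)).1, by rw [(key 0 (by simpa)).2]; simp⟩
    · exact ⟨_, (key _ hε2).1, by rw [(key _ hε2).2]; exact sign_neg (by nlinarith)⟩
    · exact ⟨_, (key _ hε2').1, by rw [(key _ hε2').2]; exact sign_pos (by nlinarith)⟩
  · cases σ
    · exact ⟨_, (key 0 (by simpa)).1, by rw [(key 0 (by simpa)).2]; simp⟩
    · exact ⟨_, (key _ hε2').1, by rw [(key _ hε2').2]; exact sign_neg (by nlinarith)⟩
    · exact ⟨_, (key _ hε2).1, by rw [(key _ hε2).2]; exact sign_pos (by nlinarith)⟩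

theorem cast_card_signType_eq_one : ∀ T : Finset SignType, T.Nonempty →
    (∀ a ∈ T, ∀ b ∈ T, a ≠ b → ∀ c, c ∈ T) → (T.card : ZMod 2) = 1 := by
  decide

/-- A new hyperplane leaves a cell whole or cuts it into three cells, so each fibre of the map
forgetting the new sign is odd. This makes the count mod 2 independent of the arrangement. -/
theorem cellCount_cons {F : List (E →ₗ[ℝ] ℝ)} {P : Set E} (hP : IsUnionOfCells F P)
    (h : E →ₗ[ℝ] ℝ) : (cellCount (h :: F) P : ZMod 2) = cellCount F P := by
  classical
  set A := (finite_signPattern_image (h :: F) P).toFinset with hA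
  set B := (finite_signPattern_image F P).toFinset with hB
  have hcons : ∀ x, signPattern (h :: F) x = SignType.sign (h x) :: signPattern F x := fun _ => rfl
  have hmaps : ∀ a ∈ A, a.tail ∈ B := by
    intro a ha
    obtain ⟨x, hx, rfl⟩ := (Set.Finite.mem_toFinset _).1 ha
    exact (Set.Finite.mem_toFinset _).2 ⟨x, hx, rfl⟩
  have hfib : ∀ b ∈ B, ((A.filter fun a => a.tail = b).card : ZMod 2) = 1 := by
    intro b hb
    obtain ⟨x, hx, rfl⟩ := (Set.Finite.mem_toFinset _).1 hb
    set T : Finset SignType := Finset.univ.filter fun σ => σ :: signPattern F x ∈ A with hT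
    have hmemT : ∀ σ, σ ∈ T ↔ ∃ z ∈ P, SignType.sign (h z) = σ ∧
        signPattern F z = signPattern F x := by
      intro σ
      simp [hT, hA, hcons]
    have him : (A.filter fun a => a.tail = signPattern F x) =
        T.image fun σ => σ :: signPattern F x := by
      ext a
      simp only [Finset.mem_filter, Finset.mem_image, hmemT, hA, Set.Finite.mem_toFinset,
        Set.mem_image]
      constructor
      · rintro ⟨⟨z, hz, rfl⟩, hzx⟩
        exact ⟨_, ⟨z, hz, rfl, hzx⟩, by rw [hcons, ← hzx]; rfl⟩
      · rintro ⟨_, ⟨z, hz, rfl, hzx⟩, rfl⟩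
        exact ⟨⟨z, hz, by rw [hcons, hzx]⟩, rfl⟩
    rw [him, Finset.card_image_of_injective _ (fun a b hab => (List.cons.inj hab).1)]
    refine cast_card_signType_eq_one T ⟨_, (hmemT _).2 ⟨x, hx, rfl, rfl⟩⟩ ?_
    intro a ha b hb hab c
    obtain ⟨z, hz, rfl, hzx⟩ := (hmemT a).1 ha
    obtain ⟨w, hw, rfl, hwx⟩ := (hmemT b).1 hb
    obtain ⟨u, hu, hc⟩ := exists_sign_eq_of_sign_ne (hzx.trans hwx.symm) hab c
    exact (hmemT c).2 ⟨u, hP z u hu.symm hz, hc, hu.trans hzx⟩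
  have h1 : cellCount (h :: F) P = A.card := Set.ncard_eq_toFinset_card _ _
  have h2 : cellCount F P = B.card := Set.ncard_eq_toFinset_card _ _
  rw [h1, h2, Finset.card_eq_sum_card_fiberwise hmaps, Nat.cast_sum, Finset.sum_congr rfl hfib]
  simp

theorem cellCount_append {F : List (E →ₗ[ℝ] ℝ)} {P : Set E} (hP : IsUnionOfCells F P)
    (G : List (E →ₗ[ℝ] ℝ)) : (cellCount (G ++ F) P : ZMod 2) = cellCount F P := by
  induction G with
  | nil => rfl
  | cons g G ih =>
    rw [List.cons_append, cellCount_cons (hP.mono fun f hf => List.mem_append_right _ hf), ih]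

theorem cellCount_eq_of_isUnionOfCells {F G : List (E →ₗ[ℝ] ℝ)} {P : Set E}
    (hF : IsUnionOfCells F P) (hG : IsUnionOfCells G P) :
    (cellCount F P : ZMod 2) = cellCount G P := by
  rw [← cellCount_append hF G, ← cellCount_append hG F]
  congr 1
  refine ncard_image_eq_of_ker_eq fun x _ y _ => ?_
  simp only [signPattern_eq_iff, List.mem_append]
  exact ⟨fun h f hf => h f hf.symm, fun h f hf => h f hf.symm⟩

open Classical in
/-- The Euler characteristic mod 2 (with compact supports) of a constructible set. -/
noncomputable def eulerMod (P : Set E) : ZMod 2 :=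
  if h : IsConstructible P then (cellCount h.choose P : ZMod 2) else 0

theorem eulerMod_eq {F : List (E →ₗ[ℝ] ℝ)} {P : Set E} (h : IsUnionOfCells F P) :
    eulerMod P = cellCount F P := by
  have hP : IsConstructible P := ⟨F, h⟩
  rw [eulerMod, dif_pos hP]
  exact cellCount_eq_of_isUnionOfCells hP.choose_spec h

theorem IsUnionOfCells.union {F : List (E →ₗ[ℝ] ℝ)} {P Q : Set E} (hP : IsUnionOfCells F P)
    (hQ : IsUnionOfCells F Q) : IsUnionOfCells F (P ∪ Q) := fun x y hxy =>
  Or.imp (hP x y hxy) (hQ x y hxy)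

theorem IsUnionOfCells.inter {F : List (E →ₗ[ℝ] ℝ)} {P Q : Set E} (hP : IsUnionOfCells F P)
    (hQ : IsUnionOfCells F Q) : IsUnionOfCells F (P ∩ Q) := fun x y hxy =>
  And.imp (hP x y hxy) (hQ x y hxy)

theorem IsConstructible.exists_common {P Q : Set E} (hP : IsConstructible P)
    (hQ : IsConstructible Q) : ∃ F, IsUnionOfCells F P ∧ IsUnionOfCells F Q := by
  obtain ⟨F, hF⟩ := hP
  obtain ⟨G, hG⟩ := hQ
  exact ⟨F ++ G, hF.mono fun f hf => List.mem_append_left _ hf,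
    hG.mono fun f hf => List.mem_append_right _ hf⟩

theorem IsConstructible.union {P Q : Set E} (hP : IsConstructible P) (hQ : IsConstructible Q) :
    IsConstructible (P ∪ Q) :=
  let ⟨F, h1, h2⟩ := hP.exists_common hQ
  ⟨F, h1.union h2⟩

theorem IsConstructible.inter {P Q : Set E} (hP : IsConstructible P) (hQ : IsConstructible Q) :
    IsConstructible (P ∩ Q) :=
  let ⟨F, h1, h2⟩ := hP.exists_common hQ
  ⟨F, h1.inter h2⟩

theorem isConstructible_empty : IsConstructible (∅ : Set E) := ⟨[], fun _ _ _ h => h⟩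

theorem isConstructible_biUnion {ι : Type*} (t : Finset ι) {P : ι → Set E}
    (h : ∀ i ∈ t, IsConstructible (P i)) : IsConstructible (⋃ i ∈ t, P i) := by
  classical
  induction t using Finset.induction_on with
  | empty => simpa using isConstructible_empty
  | insert a t _ ih =>
    rw [Finset.set_biUnion_insert]
    exact (h _ (Finset.mem_insert_self _ _)).union (ih fun i hi => h i (Finset.mem_insert_of_mem hi))

theorem eulerMod_empty : eulerMod (∅ : Set E) = 0 := by
  rw [eulerMod_eq (F := []) (fun _ _ _ h => h)]
  simp [cellCount]

theorem eulerMod_union_add_inter {P Q : Set E} (hP : IsConstructible P) (hQ : IsConstructible Q) :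
    eulerMod (P ∪ Q) + eulerMod (P ∩ Q) = eulerMod P + eulerMod Q := by
  obtain ⟨F, h1, h2⟩ := hP.exists_common hQ
  rw [eulerMod_eq h1, eulerMod_eq h2, eulerMod_eq (h1.union h2), eulerMod_eq (h1.inter h2)]
  have hi : signPattern F '' (P ∩ Q) = signPattern F '' P ∩ signPattern F '' Q := by
    refine (Set.image_inter_subset _ _ _).antisymm ?_
    rintro _ ⟨⟨x, hx, rfl⟩, y, hy, hyx⟩
    exact ⟨x, ⟨hx, h2 y x hyx hy⟩, rfl⟩
  simp only [cellCount, hi, Set.image_union]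
  exact_mod_cast congrArg (Nat.cast : ℕ → ZMod 2) (Set.ncard_union_add_ncard_inter _ _
    (finite_signPattern_image F P) (finite_signPattern_image F Q))

theorem eulerMod_biUnion {ι : Type*} (t : Finset ι) {P : ι → Set E}
    (h : ∀ i ∈ t, IsConstructible (P i)) (hd : (t : Set ι).PairwiseDisjoint P) :
    eulerMod (⋃ i ∈ t, P i) = ∑ i ∈ t, eulerMod (P i) := by
  classical
  induction t using Finset.induction_on with
  | empty => simpa using eulerMod_empty
  | insert a t ha ih =>
    rw [Finset.set_biUnion_insert, Finset.sum_insert ha,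
      ← ih (fun i hi => h i (Finset.mem_insert_of_mem hi))
        (hd.subset (by simp [Finset.coe_insert])),
      ← eulerMod_union_add_inter (h a (Finset.mem_insert_self _ _))
        (isConstructible_biUnion t fun i hi => h i (Finset.mem_insert_of_mem hi))]
    have : P a ∩ ⋃ i ∈ t, P i = ∅ := by
      rw [← Set.disjoint_iff_inter_eq_empty, Set.disjoint_iUnion₂_right]
      intro i hi
      exact hd (by simp) (by simp [hi]) (by rintro rfl; exact ha hi)
    rw [this, eulerMod_empty, add_zero]

theorem eulerMod_univ : eulerMod (Set.univ : Set E) = 1 := by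
  rw [eulerMod_eq (F := []) (fun _ _ _ h => h)]
  have : signPattern ([] : List (E →ₗ[ℝ] ℝ)) '' Set.univ = {[]} := by
    ext a
    simp [signPattern, eq_comm]
  simp [cellCount, this]

/-- The main step in the invariance of `eulerMod` under linear maps that are injective on the
set: cells of the image determine the cells of the source. -/
theorem exists_arrangement_image [FiniteDimensional ℝ E'] (A : E →ₗ[ℝ] E')
    (F : List (E →ₗ[ℝ] ℝ)) :
    ∃ G : List (E' →ₗ[ℝ] ℝ), ∀ P : Set E, IsUnionOfCells F P → Set.InjOn A P →
      ∀ x ∈ P, ∀ y, signPattern G (A x) = signPattern G y →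
        ∃ z ∈ P, A z = y ∧ signPattern F z = signPattern F x := by
  classical
  -- For each set S of functionals, B inverts A on their common kernel whenever A is injective
  -- there. One arrangement on `E'` records, for all subsets S of F at once, the signs of F along B
  -- and the equations y = A (B y).
  have hB : ∀ S : Set (E →ₗ[ℝ] ℝ), ∃ B : E' →ₗ[ℝ] E,
      (∀ k, A k = 0 → (∀ f ∈ S, f k = 0) → k = 0) →
        ∀ x, (∀ f ∈ S, f x = 0) → B (A x) = x := by
    intro S
    by_cases hS : ∀ k, A k = 0 → (∀ f ∈ S, f k = 0) → k = 0
    · let W : Submodule ℝ E := ⨅ f ∈ S, LinearMap.ker f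
      have hW : ∀ x, x ∈ W ↔ ∀ f ∈ S, f x = 0 := fun x => by simp [W]
      obtain ⟨B, hB⟩ := LinearMap.exists_leftInverse_of_injective (A.domRestrict W) (by
        rw [LinearMap.ker_eq_bot']
        rintro ⟨k, hk⟩ h0
        exact Subtype.ext (hS k h0 ((hW k).1 hk)))
      refine ⟨W.subtype ∘ₗ B, fun _ x hx => ?_⟩
      have := LinearMap.congr_fun hB ⟨x, (hW x).2 hx⟩
      exact congrArg Subtype.val this
    · exact ⟨0, fun h => absurd h hS⟩
  choose B hB using hB
  let b := Module.finBasis ℝ E'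
  let Gof : Set (E →ₗ[ℝ] ℝ) → List (E' →ₗ[ℝ] ℝ) := fun S =>
    F.map (fun f => f ∘ₗ B S) ++
      (Finset.univ.toList.map fun i => b.coord i ∘ₗ (LinearMap.id - A ∘ₗ B S))
  refine ⟨(F.toFinset.powerset.toList.map fun S : Finset (E →ₗ[ℝ] ℝ) => Gof (S : Set (E →ₗ[ℝ] ℝ))).flatten, ?_⟩
  intro P hP hinj x hx y hxy
  set S : Finset (E →ₗ[ℝ] ℝ) := F.toFinset.filter fun f => f x = 0 with hSdef
  have hSx : ∀ f ∈ (S : Set (E →ₗ[ℝ] ℝ)), f x = 0 := fun f hf => by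
    simpa using (Finset.mem_filter.1 hf).2
  -- The cell of x is open in the common kernel of the functionals vanishing at x. A kernel vector
  -- of A in that subspace would move x inside P without changing its image.
  have hSinj : ∀ k, A k = 0 → (∀ f ∈ (S : Set (E →ₗ[ℝ] ℝ)), f k = 0) → k = 0 := by
    intro k hk hk0
    have ev : ∀ᶠ τ in 𝓝 (0 : ℝ), ∀ f ∈ {f | f ∈ F},
        SignType.sign (f x + τ * f k) = SignType.sign (f x) := by
      rw [Filter.eventually_all_finite (List.finite_toSet F)]
      intro f hf
      by_cases hfx : f x = 0
      · have : f k = 0 := hk0 f (by simpa [hSdef, hfx] using hf)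
        simp [hfx, this]
      · exact sign_eventually_eq (by fun_prop) (by simp) hfx
    obtain ⟨ε, hε, hball⟩ := Metric.eventually_nhds_iff.1 ev
    have hε2 : dist (ε / 2) 0 < ε := by
      rw [Real.dist_eq, sub_zero, abs_of_pos (by positivity)]; linarith
    have hmem : x + (ε / 2) • k ∈ P := by
      refine hP x _ (signPattern_eq_iff.2 fun f hf => ?_) hx
      simpa using (hball hε2 f hf).symm
    have := hinj hx hmem (by simp [hk])
    simpa [hε.ne'] using this
  have hBS := hB (S : Set (E →ₗ[ℝ] ℝ)) hSinj x hSx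
  have hG : ∀ g ∈ Gof S, SignType.sign (g (A x)) = SignType.sign (g y) := fun g hg =>
    signPattern_eq_iff.1 hxy g (by
      simp only [List.mem_flatten, List.mem_map, Finset.mem_toList, Finset.mem_powerset]
      exact ⟨_, ⟨S, Finset.filter_subset _ _, rfl⟩, hg⟩)
  have hsign : signPattern F (B S y) = signPattern F x := by
    refine signPattern_eq_iff.2 fun f hf => ?_
    have := hG (f ∘ₗ B S) (List.mem_append_left _ (List.mem_map.2 ⟨f, hf, rfl⟩))
    simpa [hBS] using this.symm
  refine ⟨B S y, hP _ _ hsign.symm hx, ?_, hsign⟩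
  have : ∀ i, b.coord i (y - A (B S y)) = 0 := by
    intro i
    have := hG (b.coord i ∘ₗ (LinearMap.id - A ∘ₗ B S))
      (List.mem_append_right _ (List.mem_map.2 ⟨i, by simp, rfl⟩))
    simp only [LinearMap.comp_apply, LinearMap.sub_apply, LinearMap.id_apply, hBS, sub_self,
      map_zero, sign_zero] at this
    exact sign_eq_zero_iff.1 this.symm
  have h0 : y - A (B S y) = 0 := b.ext_elem fun i => by simpa using this i
  exact (sub_eq_zero.1 h0).symm

theorem IsConstructible.image [FiniteDimensional ℝ E'] {A : E →ₗ[ℝ] E'} {P : Set E}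
    (hP : IsConstructible P) (hA : Set.InjOn A P) : IsConstructible (A '' P) := by
  obtain ⟨F, hF⟩ := hP
  obtain ⟨G, hG⟩ := exists_arrangement_image A F
  refine ⟨G, ?_⟩
  rintro _ y hxy ⟨x, hx, rfl⟩
  obtain ⟨z, hz, rfl, _⟩ := hG P hF hA x hx y hxy
  exact ⟨z, hz, rfl⟩

theorem eulerMod_image [FiniteDimensional ℝ E'] {A : E →ₗ[ℝ] E'} {P : Set E}
    (hP : IsConstructible P) (hA : Set.InjOn A P) : eulerMod (A '' P) = eulerMod P := by
  obtain ⟨F, hF⟩ := hP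
  obtain ⟨G, hG⟩ := exists_arrangement_image A F
  have hG' : IsUnionOfCells G (A '' P) := by
    rintro _ y hxy ⟨x, hx, rfl⟩
    obtain ⟨z, hz, rfl, _⟩ := hG P hF hA x hx y hxy
    exact ⟨z, hz, rfl⟩
  -- After refining F by the pullback of G, the cells of P correspond one to one to the cells of its
  -- image.
  rw [eulerMod_eq hG', eulerMod_eq hF, ← cellCount_append hF (G.map fun g => g ∘ₗ A)]
  congr 1
  rw [cellCount, Set.image_image]
  refine ncard_image_eq_of_ker_eq fun x hx y hy => ?_
  simp only [signPattern_eq_iff, List.mem_append, List.mem_map]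
  constructor
  · intro h
    obtain ⟨z, hz, hzy, hzx⟩ := hG P hF hA x hx (A y) (signPattern_eq_iff.2 h)
    obtain rfl := hA hz hy hzy
    rintro f (⟨g, hg, rfl⟩ | hf)
    · exact h g hg
    · exact (signPattern_eq_iff.1 hzx f hf).symm
  · exact fun h g hg => h _ (Or.inl ⟨g, hg, rfl⟩)

end SignPattern

/-! ### Simplicial cones and their subdivisions -/

section Conic

variable {E : Type*} [AddCommGroup E] [Module ℝ E] {ι : Type*}

/-- The convex cone generated by the vectors `v i`, `i ∈ s`. -/
def conic (v : ι → E) (s : Finset ι) : Set E :=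
  (PointedCone.hull ℝ (v '' (s : Set ι)) : Set E)

theorem mem_conic {v : ι → E} {s : Finset ι} {x : E} :
    x ∈ conic v s ↔ ∃ c : ι → ℝ, (∀ i ∈ s, 0 ≤ c i) ∧ ∑ i ∈ s, c i • v i = x := by
  classical
  rw [conic, SetLike.mem_coe, PointedCone.hull, Submodule.mem_span_image_finset_iff_exists_fun']
  constructor
  · rintro ⟨c, hc⟩
    exact ⟨fun i => c i, fun i _ => (c i).2, hc⟩
  · rintro ⟨c, h0, hc⟩
    refine ⟨fun i => if h : i ∈ s then ⟨c i, h0 i h⟩ else 0, ?_⟩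
    rw [← hc]
    refine Finset.sum_congr rfl fun i hi => ?_
    simp only [hi, dif_pos]
    rfl

theorem mem_conic_self {v : ι → E} {s : Finset ι} {i : ι} (hi : i ∈ s) : v i ∈ conic v s :=
  PointedCone.subset_hull ⟨i, hi, rfl⟩

theorem conic_subset {v : ι → E} {s : Finset ι} {κ : Type*} {w : κ → E} {t : Finset κ}
    (h : ∀ i ∈ s, v i ∈ conic w t) : conic v s ⊆ conic w t := by
  have : PointedCone.hull ℝ (v '' (s : Set ι)) ≤ PointedCone.hull ℝ (w '' (t : Set κ)) :=
    Submodule.span_le.2 (by rintro _ ⟨i, hi, rfl⟩; exact h i hi)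
  exact this

theorem conic_mono {v : ι → E} {s t : Finset ι} (h : s ⊆ t) : conic v s ⊆ conic v t :=
  conic_subset fun _ hi => mem_conic_self (h hi)

theorem image_conic {E' : Type*} [AddCommGroup E'] [Module ℝ E'] (g : E →ₗ[ℝ] E') (v : ι → E)
    (s : Finset ι) : g '' conic v s = conic (g ∘ v) s := by
  ext x
  simp only [Set.mem_image, mem_conic]
  constructor
  · rintro ⟨_, ⟨c, h0, rfl⟩, rfl⟩
    exact ⟨c, h0, by simp⟩
  · rintro ⟨c, h0, rfl⟩
    exact ⟨_, ⟨c, h0, rfl⟩, by simp⟩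

theorem isCone_conic (v : ι → E) (s : Finset ι) : IsCone (conic v s) :=
  isCone_hull (s.finite_toSet.image v)

theorem sum_smul_update [DecidableEq ι] {v : ι → E} {s : Finset ι} {c : ι → ℝ} {i : ι} (hi : i ∈ s) (b : ι → ℝ) :
    ∑ l ∈ s, b l • Function.update v i (∑ j ∈ s, c j • v j) l =
      ∑ l ∈ s, ((if l = i then 0 else b l) + b i * c l) • v l := by
  simp only [add_smul, Finset.sum_add_distrib, mul_smul, ← Finset.smul_sum]
  rw [← Finset.add_sum_erase _ _ hi, ← Finset.add_sum_erase s
    (fun l => (if l = i then (0 : ℝ) else b l) • v l) hi, add_comm]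
  simp only [Function.update_self, if_true, zero_smul, zero_add]
  congr 1
  refine Finset.sum_congr rfl fun l hl => ?_
  rw [Function.update_of_ne (Finset.ne_of_mem_erase hl), if_neg (Finset.ne_of_mem_erase hl)]

theorem linearIndepOn_update [DecidableEq ι] {v : ι → E} {s : Finset ι}
    (hv : LinearIndepOn ℝ v (s : Set ι))
    {c : ι → ℝ} {i : ι} (hi : i ∈ s) (hc : c i ≠ 0) :
    LinearIndepOn ℝ (Function.update v i (∑ j ∈ s, c j • v j)) (s : Set ι) := by
  rw [linearIndepOn_finset_iff] at hv ⊢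
  intro b hb
  rw [sum_smul_update hi] at hb
  have h := hv _ hb
  have hbi : b i = 0 := by simpa [hc] using h i hi
  intro l hl
  by_cases hli : l = i
  · rw [hli, hbi]
  · simpa [hli, hbi] using h l hl

/-- Stellar subdivision: the pieces cover. -/
theorem conic_eq_biUnion_update [DecidableEq ι] {v : ι → E} {s : Finset ι} {c : ι → ℝ} (hc : ∀ i ∈ s, 0 ≤ c i)
    (hne : ∃ i ∈ s, 0 < c i) :
    conic v s = ⋃ i ∈ s.filter (fun i => 0 < c i),
      conic (Function.update v i (∑ j ∈ s, c j • v j)) s := by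
  apply Set.Subset.antisymm
  · intro x hx
    obtain ⟨b, hb, rfl⟩ := mem_conic.1 hx
    -- Subtract the largest multiple of the centre that keeps all coordinates nonnegative; the
    -- coordinate that reaches zero first names the piece containing the point.
    obtain ⟨i, hi, hmin⟩ := Finset.exists_min_image (s.filter fun i => 0 < c i)
      (fun i => b i / c i) (by simpa [Finset.Nonempty] using hne)
    obtain ⟨his, hci⟩ := Finset.mem_filter.1 hi
    refine Set.mem_biUnion hi (mem_conic.2 ⟨fun l => if l = i then b i / c i
      else b l - b i / c i * c l, ?_, ?_⟩)
    · intro l hl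
      by_cases hli : l = i
      · simp only [hli, if_true]
        exact div_nonneg (hb i his) hci.le
      · simp only [hli, if_false, sub_nonneg]
        rcases (hc l hl).eq_or_lt with h0 | h0
        · rw [← h0, mul_zero]
          exact hb l hl
        · have := hmin l (Finset.mem_filter.2 ⟨hl, h0⟩)
          rwa [le_div_iff₀ h0] at this
    · rw [sum_smul_update his]
      refine Finset.sum_congr rfl fun l _ => ?_
      by_cases hli : l = i
      · subst hli
        simp [hci.ne']
      · simp [hli]
  · refine Set.iUnion₂_subset fun i _ => conic_subset fun l hl => ?_
    by_cases hli : l = i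
    · subst hli
      rw [Function.update_self]
      exact mem_conic.2 ⟨c, hc, rfl⟩
    · rw [Function.update_of_ne hli]
      exact mem_conic_self hl

/-- Stellar subdivision: two pieces meet in a common face. -/
theorem conic_update_inter [DecidableEq ι] {v : ι → E} {s : Finset ι} (hv : LinearIndepOn ℝ v (s : Set ι))
    {c : ι → ℝ} {i j : ι} (hi : i ∈ s) (hj : j ∈ s) (hij : i ≠ j) (hci : 0 < c i)
    (hcj : 0 < c j) :
    conic (Function.update v i (∑ l ∈ s, c l • v l)) s ∩
        conic (Function.update v j (∑ l ∈ s, c l • v l)) s =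
      conic (Function.update v i (∑ l ∈ s, c l • v l)) (s.erase j) := by
  apply Set.Subset.antisymm
  · rintro x ⟨hx, hx'⟩
    obtain ⟨b, hb, rfl⟩ := mem_conic.1 hx
    obtain ⟨b', hb', hbb⟩ := mem_conic.1 hx'
    rw [sum_smul_update hi, sum_smul_update hj] at hbb
    have h := linearIndepOn_finset_iffₛ.1 hv _ _ hbb
    have h1 := h i hi
    have h2 := h j hj
    simp only [if_true, hij, hij.symm, if_false, zero_add] at h1 h2
    have h3 := hb' i hi
    have h4 := hb j hj
    -- The coefficients at i give b' j ≤ b i, and those at j give b j = (b' j - b i) * c j, so b j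
    -- is both nonnegative and nonpositive.
    have hbj : b j = 0 := by
      have h5 : b' j ≤ b i := by nlinarith
      have h6 := mul_le_mul_of_nonneg_right h5 hcj.le
      linarith
    refine mem_conic.2 ⟨b, fun l hl => hb l (Finset.mem_of_mem_erase hl), ?_⟩
    refine Finset.sum_erase s ?_
    rw [hbj, zero_smul]
  · refine Set.subset_inter (conic_mono (Finset.erase_subset _ _)) (conic_subset fun l hl => ?_)
    obtain ⟨hlj, hls⟩ := Finset.mem_erase.1 hl
    by_cases hli : l = i
    · subst hli
      rw [Function.update_self]
      convert mem_conic_self (v := Function.update v j (∑ l ∈ s, c l • v l)) hj using 1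
      rw [Function.update_self]
    · rw [Function.update_of_ne hli]
      convert mem_conic_self (v := Function.update v j (∑ l ∈ s, c l • v l)) hls using 1
      rw [Function.update_of_ne hlj]

/-- Carathéodory's theorem for cones. -/
theorem exists_linearIndepOn_of_mem_conic {v : ι → E} {s : Finset ι} {x : E}
    (hx : x ∈ conic v s) :
    ∃ t ⊆ s, LinearIndepOn ℝ v (t : Set ι) ∧ x ∈ conic v t := by
  classical
  induction hn : s.card using Nat.strong_induction_on generalizing s with
  | _ n ih =>
    by_cases hv : LinearIndepOn ℝ v (s : Set ι)
    · exact ⟨s, subset_rfl, hv, hx⟩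
    obtain ⟨a, ha0, i₀, hi₀, hapos⟩ : ∃ a : ι → ℝ, ∑ i ∈ s, a i • v i = 0 ∧ ∃ i ∈ s, 0 < a i := by
      rw [linearIndepOn_finset_iff] at hv
      push Not at hv
      obtain ⟨a, ha0, i, hi, hai⟩ := hv
      rcases lt_or_gt_of_ne hai with h | h
      · exact ⟨fun i => -a i, by simp [ha0], i, hi, by linarith⟩
      · exact ⟨a, ha0, i, hi, h⟩
    obtain ⟨b, hb, rfl⟩ := mem_conic.1 hx
    -- Subtracting the linear relation until the first coefficient vanishes makes one generator
    -- superfluous.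
    obtain ⟨i, hi, hmin⟩ := Finset.exists_min_image (s.filter fun i => 0 < a i)
      (fun i => b i / a i) ⟨i₀, by simp [hi₀, hapos]⟩
    obtain ⟨his, hai⟩ := Finset.mem_filter.1 hi
    have hmem : ∑ l ∈ s, b l • v l ∈ conic v (s.erase i) := by
      refine mem_conic.2 ⟨fun l => b l - b i / a i * a l, ?_, ?_⟩
      · intro l hl
        rw [sub_nonneg]
        have hls := Finset.mem_of_mem_erase hl
        rcases le_or_gt (a l) 0 with h0 | h0
        · exact (mul_nonpos_of_nonneg_of_nonpos (div_nonneg (hb i his) hai.le) h0).trans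
            (hb l hls)
        · have := hmin l (Finset.mem_filter.2 ⟨hls, h0⟩)
          rwa [le_div_iff₀ h0] at this
      · have : ∑ l ∈ s, (b l - b i / a i * a l) • v l = ∑ l ∈ s, b l • v l := by
          simp only [sub_smul, mul_smul, Finset.sum_sub_distrib, ← Finset.smul_sum, ha0,
            smul_zero, sub_zero]
        rw [← this, ← Finset.add_sum_erase s _ his]
        simp [hai.ne']
    obtain ⟨t, ht, h1, h2⟩ := ih _ (hn ▸ Finset.card_erase_lt_of_mem his) hmem rfl
    exact ⟨t, ht.trans (Finset.erase_subset _ _), h1, h2⟩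

/-- The intersection of finitely many closed half-spaces. -/
def halfspaces (F : List (E →ₗ[ℝ] ℝ)) : Set E := {x | ∀ h ∈ F, 0 ≤ h x}

/-- With a left inverse L of the coordinate map A, the cone is cut out by the coordinates of L x
being nonnegative and by x = A (L x). Each linear equation counts as two opposite half-spaces. -/
theorem exists_conic_eq_halfspaces [FiniteDimensional ℝ E] {v : ι → E} {s : Finset ι}
    (hv : LinearIndepOn ℝ v (s : Set ι)) : ∃ F, conic v s = halfspaces F := by
  classical
  have hv' : LinearIndependent ℝ (fun i : s => v i) := hv
  let A := Fintype.linearCombination ℝ (fun i : s => v i)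
  obtain ⟨L, hL⟩ := LinearMap.exists_leftInverse_of_injective A
    (LinearMap.ker_eq_bot.2 hv'.fintypeLinearCombination_injective)
  let b := Module.finBasis ℝ E
  refine ⟨(Finset.univ.toList.map fun i : s => LinearMap.proj i ∘ₗ L) ++
    ((Finset.univ.toList.map fun j => b.coord j ∘ₗ (LinearMap.id - A ∘ₗ L)) ++
      (Finset.univ.toList.map fun j => -(b.coord j ∘ₗ (LinearMap.id - A ∘ₗ L)))), ?_⟩
  have hiff : ∀ x, x ∈ conic v s ↔ (∀ i, 0 ≤ L x i) ∧ ∀ j, b.coord j (x - A (L x)) = 0 := by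
    intro x
    rw [mem_conic]
    constructor
    · rintro ⟨c, hc, rfl⟩
      have h1 : ∑ i ∈ s, c i • v i = A (fun i => c i) := by
        rw [Fintype.linearCombination_apply, ← Finset.sum_coe_sort]
      have h2 : L (∑ i ∈ s, c i • v i) = fun i : s => c i := by
        rw [h1]; exact LinearMap.congr_fun hL _
      refine ⟨fun i => ?_, fun j => ?_⟩
      · rw [h2]; exact hc i i.2
      · rw [h2, h1, sub_self, map_zero]
    · rintro ⟨h0, h1⟩
      have h2 : x - A (L x) = 0 := b.ext_elem fun j => by simpa using h1 j
      refine ⟨fun i => if h : i ∈ s then L x ⟨i, h⟩ else 0, fun i hi => ?_, ?_⟩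
      · simp only [hi, dif_pos, h0]
      · rw [sub_eq_zero] at h2
        conv_rhs => rw [h2]
        rw [Fintype.linearCombination_apply, ← Finset.sum_coe_sort]
        simp
  ext x
  rw [hiff]
  simp only [halfspaces, Set.mem_ofPred_eq, List.mem_append, List.mem_map, Finset.mem_toList,
    Finset.mem_univ, true_and]
  constructor
  · rintro ⟨h0, h1⟩ h (⟨i, rfl⟩ | ⟨j, rfl⟩ | ⟨j, rfl⟩)
    · exact h0 i
    · exact (h1 j).ge
    · exact (neg_eq_zero.2 (h1 j)).ge
  · intro h
    refine ⟨fun i => h _ (Or.inl ⟨i, rfl⟩), fun j => le_antisymm ?_ ?_⟩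
    · exact neg_nonneg.1 (h _ (Or.inr (Or.inr ⟨j, rfl⟩)))
    · exact h _ (Or.inr (Or.inl ⟨j, rfl⟩))

theorem halfspaces_inter (F G : List (E →ₗ[ℝ] ℝ)) :
    halfspaces F ∩ halfspaces G = halfspaces (F ++ G) := by
  ext x
  simp only [halfspaces, Set.mem_inter_iff, Set.mem_ofPred_eq, List.mem_append]
  exact ⟨fun h f hf => hf.elim (h.1 f) (h.2 f),
    fun h => ⟨fun f hf => h f (Or.inl hf), fun f hf => h f (Or.inr hf)⟩⟩

theorem isConstructible_halfspaces (F : List (E →ₗ[ℝ] ℝ)) : IsConstructible (halfspaces F) := by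
  refine ⟨F, fun x y hxy hx h hh => ?_⟩
  have := signPattern_eq_iff.1 hxy h hh
  rw [← sign_nonneg_iff, ← this, sign_nonneg_iff]
  exact hx h hh

/-- Every cone is a finite union of simplicial cones. -/
theorem IsCone.exists_eq_biUnion_conic {P : Set E} (hP : IsCone P) :
    ∃ T : Finset (Finset E), (∀ t ∈ T, LinearIndepOn ℝ id (t : Set E)) ∧
      P = ⋃ t ∈ T, conic id t := by
  classical
  obtain ⟨S, hS, hconv, rfl⟩ := hP
  have : ∀ C ∈ S, ∃ s : Finset E, C = conic id s := by
    intro C hC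
    obtain ⟨s, hs, rfl⟩ := hconv C hC
    exact ⟨hs.toFinset, by simp [conic]⟩
  choose! g hg using this
  have hfin : {t : Finset E | LinearIndepOn ℝ id (t : Set E) ∧ ∃ C ∈ S, t ⊆ g C}.Finite := by
    refine ((hS.toFinset.biUnion fun C => (g C).powerset).finite_toSet).subset ?_
    rintro t ⟨_, C, hC, ht⟩
    simp only [Finset.coe_biUnion, Set.mem_iUnion, Finset.mem_coe]
    exact ⟨C, by simpa using hC, Finset.mem_powerset.2 ht⟩
  refine ⟨hfin.toFinset, fun t ht => ((Set.Finite.mem_toFinset _).1 ht).1, ?_⟩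
  ext x
  simp only [Set.mem_sUnion, Set.Finite.mem_toFinset, Set.mem_ofPred_eq, Set.mem_iUnion,
    exists_prop]
  constructor
  · rintro ⟨C, hC, hx⟩
    rw [hg C hC] at hx
    obtain ⟨t, h1, h2, h3⟩ := exists_linearIndepOn_of_mem_conic hx
    exact ⟨t, ⟨h2, C, hC, h1⟩, h3⟩
  · rintro ⟨t, ⟨_, C, hC, ht⟩, hx⟩
    refine ⟨C, hC, ?_⟩
    rw [hg C hC]
    exact conic_mono ht hx

theorem IsCone.isConstructible [FiniteDimensional ℝ E] {P : Set E} (hP : IsCone P) :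
    IsConstructible P := by
  obtain ⟨T, hT, rfl⟩ := hP.exists_eq_biUnion_conic
  refine isConstructible_biUnion T fun t ht => ?_
  obtain ⟨F, hF⟩ := exists_conic_eq_halfspaces (hT t ht)
  rw [hF]
  exact isConstructible_halfspaces F

end Conic

/-! ### Generation of `L_n` by simplices -/

section Generation

variable {n : ℕ}

theorem IsCone.union {E : Type*} [AddCommGroup E] [Module ℝ E] {P Q : Set E} (hP : IsCone P)
    (hQ : IsCone Q) : IsCone (P ∪ Q) := by
  obtain ⟨S, hS, h1, rfl⟩ := hP
  obtain ⟨T, hT, h2, rfl⟩ := hQ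
  exact ⟨S ∪ T, hS.union hT, fun C hC => hC.elim (h1 C) (h2 C), Set.sUnion_union S T |>.symm⟩

theorem isCone_empty {E : Type*} [AddCommGroup E] [Module ℝ E] : IsCone (∅ : Set E) :=
  ⟨∅, Set.finite_empty, by simp, by simp⟩

theorem IsCone.biUnion {E : Type*} [AddCommGroup E] [Module ℝ E] {κ : Type*} (t : Finset κ)
    {Q : κ → Set E} (hQ : ∀ i, IsCone (Q i)) : IsCone (⋃ i ∈ t, Q i) := by
  classical
  induction t using Finset.induction_on with
  | empty => simpa using isCone_empty
  | insert a t _ ih =>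
    rw [Finset.set_biUnion_insert]
    exact (hQ a).union ih

theorem coneClass_congr {P Q : Set (EuclideanSpace ℝ (Fin n))} (h : P = Q) (hP : IsCone P)
    (hQ : IsCone Q) : coneClass P hP = coneClass Q hQ := by
  subst h; rfl

theorem coneClass_union {P Q : Set (EuclideanSpace ℝ (Fin n))} (hP : IsCone P) (hQ : IsCone Q)
    (hU : IsCone (P ∪ Q)) (hN : IsCone (P ∩ Q)) :
    coneClass (P ∪ Q) hU = coneClass P hP + coneClass Q hQ - coneClass (P ∩ Q) hN := by
  rw [← sub_eq_zero]
  exact (QuotientAddGroup.eq_zero_iff _).2 (AddSubgroup.subset_closure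
    (Or.inl (Or.inl ⟨⟨P, hP⟩, ⟨Q, hQ⟩, ⟨P ∪ Q, hU⟩, ⟨P ∩ Q, hN⟩, rfl, rfl, rfl⟩)))

theorem coneClass_empty (h : IsCone (∅ : Set (EuclideanSpace ℝ (Fin n)))) :
    coneClass ∅ h = 0 :=
  (QuotientAddGroup.eq_zero_iff _).2 (AddSubgroup.subset_closure
    (Or.inl (Or.inr ⟨⟨∅, h⟩, rfl, rfl⟩)))

theorem coneClass_image (g : EuclideanSpace ℝ (Fin n) ≃ₗᵢ[ℝ] EuclideanSpace ℝ (Fin n))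
    {P : Set (EuclideanSpace ℝ (Fin n))} (hP : IsCone P) (hQ : IsCone (g '' P)) :
    coneClass (g '' P) hQ = coneClass P hP := by
  rw [← sub_eq_zero]
  exact (QuotientAddGroup.eq_zero_iff _).2 (AddSubgroup.subset_closure
    (Or.inr ⟨g, ⟨P, hP⟩, ⟨g '' P, hQ⟩, rfl, rfl⟩))

/-- The class of the simplicial cone generated by the `v i`, `i ∈ s`. -/
noncomputable def conicClass {ι : Type*} (v : ι → EuclideanSpace ℝ (Fin n)) (s : Finset ι) :
    LGroup n :=
  coneClass (conic v s) (isCone_conic v s)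

/-- The subgroup of `L_n` generated by the simplices of dimension at most `e`. -/
def simplexGroup (n e : ℕ) : AddSubgroup (LGroup n) :=
  AddSubgroup.closure {x | ∃ (ι : Type) (v : ι → EuclideanSpace ℝ (Fin n)) (s : Finset ι),
    LinearIndepOn ℝ v (s : Set ι) ∧ s.card ≤ e ∧ x = conicClass v s}

theorem conicClass_mem_simplexGroup {ι : Type} {v : ι → EuclideanSpace ℝ (Fin n)} {s : Finset ι}
    {e : ℕ} (hv : LinearIndepOn ℝ v (s : Set ι)) (he : s.card ≤ e) :
    conicClass v s ∈ simplexGroup n e :=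
  AddSubgroup.subset_closure ⟨ι, v, s, hv, he, rfl⟩

/-- `P` is a cone whose class lies in the subgroup `K`. -/
def HasClassIn (K : AddSubgroup (LGroup n)) (P : Set (EuclideanSpace ℝ (Fin n))) : Prop :=
  ∃ h : IsCone P, coneClass P h ∈ K

theorem HasClassIn.union {K : AddSubgroup (LGroup n)} {P Q : Set (EuclideanSpace ℝ (Fin n))}
    (hP : HasClassIn K P) (hQ : HasClassIn K Q) (hN : HasClassIn K (P ∩ Q)) :
    HasClassIn K (P ∪ Q) := by
  obtain ⟨hP, hP'⟩ := hP
  obtain ⟨hQ, hQ'⟩ := hQ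
  obtain ⟨hN, hN'⟩ := hN
  refine ⟨hP.union hQ, ?_⟩
  rw [coneClass_union hP hQ _ hN]
  exact K.sub_mem (K.add_mem hP' hQ') hN'

/-- Half-spaces are removed one at a time. While h has both signs on the edges, a stellar
subdivision at a point of a two-dimensional face where h = 0 lowers the number of edges with h ≠ 0.
Once only one sign is left, the half-space h ≥ 0 keeps either the whole simplex or its face on h =
0. -/
theorem hasClassIn_conic_inter_halfspaces {e : ℕ} {ι : Type}
    (F : List (EuclideanSpace ℝ (Fin n) →ₗ[ℝ] ℝ)) :
    ∀ (v : ι → EuclideanSpace ℝ (Fin n)) (s : Finset ι), LinearIndepOn ℝ v (s : Set ι) →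
      s.card ≤ e → HasClassIn (simplexGroup n e) (conic v s ∩ halfspaces F) := by
  classical
  induction F with
  | nil =>
    intro v s hv he
    have : conic v s ∩ halfspaces [] = conic v s := by simp [halfspaces]
    rw [this]
    exact ⟨_, conicClass_mem_simplexGroup hv he⟩
  | cons h F ih =>
    intro v s hv he
    have hcons : halfspaces (h :: F) = {x | 0 ≤ h x} ∩ halfspaces F := by
      ext x; simp [halfspaces]
    induction hN : (s.filter fun i => h (v i) ≠ 0).card using Nat.strong_induction_on
      generalizing v s with
    | _ N ihN =>
      have hval : ∀ c : ι → ℝ, h (∑ i ∈ s, c i • v i) = ∑ i ∈ s, c i * h (v i) := by simp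
      by_cases hneg : ∃ j ∈ s, h (v j) < 0
      · obtain ⟨j, hj, hjneg⟩ := hneg
        by_cases hpos : ∃ i ∈ s, 0 < h (v i)
        · obtain ⟨i, hi, hipos⟩ := hpos
          have hij : i ≠ j := by rintro rfl; linarith
          -- These weights put w in the relative interior of the face spanned by edges i and j, with
          -- h w = 0.
          set c : ι → ℝ := fun l => if l = i then -h (v j) else if l = j then h (v i) else 0
            with hcdef
          have hci : c i = -h (v j) := by simp [hcdef]
          have hcj : c j = h (v i) := by simp [hcdef, hij.symm]
          have hfilter : s.filter (fun l => 0 < c l) = {i, j} := by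
            ext l
            simp only [Finset.mem_filter, Finset.mem_insert, Finset.mem_singleton]
            constructor
            · rintro ⟨_, hl⟩
              by_contra! hcon
              simp [hcdef, hcon.1, hcon.2] at hl
            · rintro (rfl | rfl)
              · exact ⟨hi, by rw [hci]; linarith⟩
              · exact ⟨hj, by rw [hcj]; exact hipos⟩
          have hc0 : ∀ l ∈ s, 0 ≤ c l := by
            intro l _
            simp only [hcdef]
            split_ifs <;> linarith
          set w := ∑ l ∈ s, c l • v l with hw
          have hhw : h w = 0 := by
            rw [hw, hval, ← Finset.sum_subset (s₁ := {i, j})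
              (by intro l hl; rw [← hfilter] at hl; exact Finset.filter_subset _ _ hl)]
            · rw [Finset.sum_pair hij, hci, hcj]; ring
            · intro l _ hl
              simp only [Finset.mem_insert, Finset.mem_singleton, not_or] at hl
              simp [hcdef, hl.1, hl.2]
          have hcover : conic v s =
              conic (Function.update v i w) s ∪ conic (Function.update v j w) s := by
            rw [conic_eq_biUnion_update hc0 ⟨i, hi, by rw [hci]; linarith⟩, hfilter,
              Finset.set_biUnion_insert, Finset.set_biUnion_singleton]
          have hinter := conic_update_inter (c := c) hv hi hj hij (by rw [hci]; linarith)
            (by rw [hcj]; exact hipos)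
          rw [← hw] at hinter
          have hcard : ∀ k ∈ s, h (v k) ≠ 0 → ∀ t ⊆ s,
              (t.filter fun l => h (Function.update v k w l) ≠ 0).card < N := by
            intro k hk hk0 t hts
            rw [← hN]
            refine Finset.card_lt_card (Finset.ssubset_iff_of_subset ?_ |>.2 ⟨k, ?_, ?_⟩)
            · intro l hl
              obtain ⟨hl1, hl2⟩ := Finset.mem_filter.1 hl
              refine Finset.mem_filter.2 ⟨hts hl1, ?_⟩
              by_cases hlk : l = k
              · subst hlk; exact hk0
              · rwa [Function.update_of_ne hlk] at hl2
            · exact Finset.mem_filter.2 ⟨hk, hk0⟩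
            · simp [hhw]
          have hvi := linearIndepOn_update hv hi (c := c) (by rw [hci]; linarith)
          have hvj := linearIndepOn_update hv hj (c := c) (by rw [hcj]; linarith)
          rw [hcover, Set.union_inter_distrib_right]
          refine HasClassIn.union
            (ihN _ (hcard i hi hipos.ne' s subset_rfl) _ _ hvi he rfl)
            (ihN _ (hcard j hj hjneg.ne s subset_rfl) _ _ hvj he rfl) ?_
          rw [← Set.inter_inter_distrib_right, hinter]
          exact ihN _ (hcard i hi hipos.ne' (s.erase j) (Finset.erase_subset _ _)) _ _
            (hvi.mono (by simp)) ((Finset.card_le_card (Finset.erase_subset _ _)).trans he) rfl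
        · push Not at hpos
          have : conic v s ∩ halfspaces (h :: F) =
              conic v (s.filter fun i => h (v i) = 0) ∩ halfspaces F := by
            rw [hcons, ← Set.inter_assoc]
            congr 1
            ext x
            constructor
            · rintro ⟨hx, hx0⟩
              obtain ⟨c, hc, rfl⟩ := mem_conic.1 hx
              have hx0 : 0 ≤ h (∑ i ∈ s, c i • v i) := hx0
              rw [hval] at hx0
              have hle : ∀ i ∈ s, c i * h (v i) ≤ 0 := fun i hi =>
                mul_nonpos_of_nonneg_of_nonpos (hc i hi) (hpos i hi)
              have h0 := (Finset.sum_eq_zero_iff_of_nonpos hle).1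
                (le_antisymm (Finset.sum_nonpos hle) hx0)
              refine mem_conic.2 ⟨c, fun i hi => hc i (Finset.filter_subset _ _ hi), ?_⟩
              refine Finset.sum_subset (Finset.filter_subset _ _) fun i hi hi' => ?_
              have : h (v i) ≠ 0 := fun h' => hi' (Finset.mem_filter.2 ⟨hi, h'⟩)
              rw [(mul_eq_zero.1 (h0 i hi)).resolve_right this, zero_smul]
            · intro hx
              refine ⟨conic_mono (Finset.filter_subset _ _) hx, ?_⟩
              obtain ⟨c, hc, rfl⟩ := mem_conic.1 hx
              change 0 ≤ h _
              rw [map_sum, Finset.sum_eq_zero]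
              intro i hi
              rw [map_smul, (Finset.mem_filter.1 hi).2, smul_zero]
          rw [this]
          exact ih v _ (hv.mono (Finset.coe_subset.2 (Finset.filter_subset _ _)))
            ((Finset.card_le_card (Finset.filter_subset _ _)).trans he)
      · push Not at hneg
        have : conic v s ∩ halfspaces (h :: F) = conic v s ∩ halfspaces F := by
          rw [hcons, ← Set.inter_assoc]
          congr 1
          refine Set.inter_eq_left.2 fun x hx => ?_
          obtain ⟨c, hc, rfl⟩ := mem_conic.1 hx
          change 0 ≤ h _
          rw [hval]
          exact Finset.sum_nonneg fun i hi => mul_nonneg (hc i hi) (hneg i hi)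
        rw [this]
        exact ih v s hv he

/-- A section of a simplex of dimension at most `e` by half-spaces. -/
def IsSimplexSection (e : ℕ) (P : Set (EuclideanSpace ℝ (Fin n))) : Prop :=
  ∃ (ι : Type) (v : ι → EuclideanSpace ℝ (Fin n)) (s : Finset ι)
    (F : List (EuclideanSpace ℝ (Fin n) →ₗ[ℝ] ℝ)),
    LinearIndepOn ℝ v (s : Set ι) ∧ s.card ≤ e ∧ P = conic v s ∩ halfspaces F

theorem isSimplexSection_conic {e : ℕ} {ι : Type} {v : ι → EuclideanSpace ℝ (Fin n)}
    {s : Finset ι} (hv : LinearIndepOn ℝ v (s : Set ι)) (he : s.card ≤ e) :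
    IsSimplexSection e (conic v s) :=
  ⟨ι, v, s, [], hv, he, by simp [halfspaces]⟩

theorem IsSimplexSection.inter {e e' : ℕ} {P Q : Set (EuclideanSpace ℝ (Fin n))}
    (hP : IsSimplexSection e P) (hQ : IsSimplexSection e' Q) : IsSimplexSection e (P ∩ Q) := by
  obtain ⟨ι, v, s, F, hv, he, rfl⟩ := hP
  obtain ⟨κ, w, t, G, hw, _, rfl⟩ := hQ
  obtain ⟨K, hK⟩ := exists_conic_eq_halfspaces hw
  refine ⟨ι, v, s, F ++ (K ++ G), hv, he, ?_⟩
  rw [hK, Set.inter_assoc, halfspaces_inter, halfspaces_inter]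

/-- Inclusion–exclusion by induction on the number of pieces: the first piece meets the union of the
others in a union of fewer pieces, which are again sections because intersections of sections are
sections. -/
theorem hasClassIn_biUnion {e : ℕ} {κ : Type*} (t : Finset κ) :
    ∀ {P : κ → Set (EuclideanSpace ℝ (Fin n))}, (∀ i ∈ t, IsSimplexSection e (P i)) →
      HasClassIn (simplexGroup n e) (⋃ i ∈ t, P i) := by
  classical
  induction t using Finset.induction_on with
  | empty =>
    intro P _
    simp only [Finset.notMem_empty, Set.iUnion_of_empty, Set.iUnion_empty]
    exact ⟨isCone_empty, by rw [coneClass_empty]; exact zero_mem _⟩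
  | insert a t _ ih =>
    intro P hP
    rw [Finset.set_biUnion_insert]
    have ha := hP a (Finset.mem_insert_self _ _)
    have ht := fun i hi => hP i (Finset.mem_insert_of_mem hi)
    refine HasClassIn.union ?_ (ih ht) ?_
    · obtain ⟨ι, v, s, F, hv, he, h⟩ := ha
      rw [h]
      exact hasClassIn_conic_inter_halfspaces F v s hv he
    · rw [Set.inter_iUnion₂]
      exact ih fun i hi => ha.inter (ht i hi)

theorem exists_coneClass_mem_simplexGroup {P : Set (EuclideanSpace ℝ (Fin n))} (hP : IsCone P) :
    ∃ e, coneClass P hP ∈ simplexGroup n e := by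
  obtain ⟨T, hT, rfl⟩ := hP.exists_eq_biUnion_conic
  obtain ⟨_, h⟩ := hasClassIn_biUnion (e := T.sup Finset.card) T
    fun t ht => isSimplexSection_conic (hT t ht) (Finset.le_sup (f := Finset.card) ht)
  exact ⟨_, h⟩

/-- The inclusion–exclusion corrections lie in pairwise intersections. When these have smaller
dimension, a dissection is additive modulo smaller simplices. -/
theorem coneClass_biUnion_sub_sum_mem {e : ℕ} {κ : Type*} {Q : κ → Set (EuclideanSpace ℝ (Fin n))}
    (hQ : ∀ i, IsCone (Q i)) (t : Finset κ)
    (hint : ∀ i ∈ t, ∀ j ∈ t, i ≠ j → IsSimplexSection e (Q i ∩ Q j))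
    (hU : IsCone (⋃ i ∈ t, Q i)) :
    coneClass (⋃ i ∈ t, Q i) hU - ∑ i ∈ t, coneClass (Q i) (hQ i) ∈ simplexGroup n e := by
  classical
  induction t using Finset.induction_on with
  | empty =>
    rw [coneClass_congr (Q := ∅) (by simp) hU isCone_empty, coneClass_empty]
    simp
  | insert a t ha ih =>
    obtain ⟨hN, hN'⟩ := hasClassIn_biUnion (e := e) t (P := fun i => Q a ∩ Q i) fun i hi =>
      hint a (Finset.mem_insert_self _ _) i (Finset.mem_insert_of_mem hi)
        (by rintro rfl; exact ha hi)
    rw [← Set.inter_iUnion₂] at hN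
    have hUt := IsCone.biUnion t hQ
    rw [coneClass_congr (Finset.set_biUnion_insert a t Q) hU ((hQ a).union hUt),
      coneClass_union (hQ a) hUt _ hN, Finset.sum_insert ha]
    have h1 := ih (fun i hi j hj => hint i (Finset.mem_insert_of_mem hi) j
      (Finset.mem_insert_of_mem hj)) hUt
    rw [coneClass_congr (Set.inter_iUnion₂ (Q a) fun i (_ : i ∈ t) => Q i).symm _ hN] at hN'
    convert (simplexGroup n e).sub_mem h1 hN' using 1
    abel

/-- Stellar subdivision modulo simplices of smaller dimension. -/
theorem conicClass_sub_sum_update_mem {ι : Type} [DecidableEq ι] {e : ℕ}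
    {v : ι → EuclideanSpace ℝ (Fin n)} {s : Finset ι} (hv : LinearIndepOn ℝ v (s : Set ι))
    (he : s.card ≤ e + 1) {c : ι → ℝ} (hc : ∀ i ∈ s, 0 ≤ c i) (hne : ∃ i ∈ s, 0 < c i) :
    conicClass v s - ∑ i ∈ s.filter (fun i => 0 < c i),
      conicClass (Function.update v i (∑ j ∈ s, c j • v j)) s ∈ simplexGroup n e := by
  have hU := IsCone.biUnion (s.filter fun i => 0 < c i) fun i =>
    isCone_conic (Function.update v i (∑ j ∈ s, c j • v j)) s
  rw [conicClass, coneClass_congr (conic_eq_biUnion_update hc hne) _ hU]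
  refine coneClass_biUnion_sub_sum_mem _ _ ?_ hU
  intro i hi j hj hij
  obtain ⟨his, hci⟩ := Finset.mem_filter.1 hi
  obtain ⟨hjs, hcj⟩ := Finset.mem_filter.1 hj
  rw [conic_update_inter hv his hjs hij hci hcj]
  refine isSimplexSection_conic ((linearIndepOn_update hv his hci.ne').mono (by simp)) ?_
  rw [Finset.card_erase_of_mem hjs]
  omega

/-- The boundary of a simplex has smaller dimension. -/
theorem coneClass_biUnion_erase_mem {ι : Type} [DecidableEq ι] {e : ℕ}
    {v : ι → EuclideanSpace ℝ (Fin n)} {s : Finset ι} (hv : LinearIndepOn ℝ v (s : Set ι))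
    (he : s.card ≤ e + 1) (h : IsCone (⋃ i ∈ s, conic v (s.erase i))) :
    coneClass (⋃ i ∈ s, conic v (s.erase i)) h ∈ simplexGroup n e := by
  obtain ⟨_, h'⟩ := hasClassIn_biUnion (e := e) s (P := fun i => conic v (s.erase i)) fun i hi =>
    isSimplexSection_conic (hv.mono (by simp)) (by rw [Finset.card_erase_of_mem hi]; omega)
  exact h'

end Generation

/-! ### The parity homomorphism and interior manifold cones -/

section Parity

theorem IsCone.zero_mem {E : Type*} [AddCommGroup E] [Module ℝ E] {P : Set E} (hP : IsCone P)
    (h : P.Nonempty) : (0 : E) ∈ P := by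
  obtain ⟨S, _, hconv, rfl⟩ := hP
  obtain ⟨x, C, hC, _⟩ := h
  obtain ⟨s, _, rfl⟩ := hconv C hC
  exact ⟨_, hC, Submodule.zero_mem _⟩

open Classical in
/-- The mod 2 sum of the Euler characteristics with compact and with closed supports of a cone. -/
noncomputable def coneParity {E : Type*} [AddCommGroup E] [Module ℝ E] (P : Set E) : ZMod 2 :=
  eulerMod P + if P.Nonempty then 1 else 0

theorem coneParity_of_nonempty {E : Type*} [AddCommGroup E] [Module ℝ E] {P : Set E}
    (h : P.Nonempty) : coneParity P = eulerMod P + 1 := by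
  rw [coneParity, if_pos h]

theorem coneParity_empty {E : Type*} [AddCommGroup E] [Module ℝ E] :
    coneParity (∅ : Set E) = 0 := by
  rw [coneParity, if_neg Set.not_nonempty_empty, eulerMod_empty, add_zero]

/-- Two nonempty cones meet, since both contain 0; hence the nonemptiness indicator is itself a
valuation on cones. -/
theorem coneParity_union_add_inter {E : Type*} [AddCommGroup E] [Module ℝ E]
    [FiniteDimensional ℝ E] {P Q : Set E} (hP : IsCone P) (hQ : IsCone Q) :
    coneParity (P ∪ Q) + coneParity (P ∩ Q) = coneParity P + coneParity Q := by
  rcases P.eq_empty_or_nonempty with rfl | h1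
  · simp [coneParity_empty, add_comm]
  rcases Q.eq_empty_or_nonempty with rfl | h2
  · simp [coneParity_empty]
  have h3 : (P ∩ Q).Nonempty := ⟨0, hP.zero_mem h1, hQ.zero_mem h2⟩
  rw [coneParity_of_nonempty h1, coneParity_of_nonempty h2,
    coneParity_of_nonempty (h1.mono Set.subset_union_left),
    coneParity_of_nonempty h3]
  have := eulerMod_union_add_inter hP.isConstructible hQ.isConstructible
  linear_combination this

theorem coneParity_image {n : ℕ} (g : EuclideanSpace ℝ (Fin n) ≃ₗᵢ[ℝ] EuclideanSpace ℝ (Fin n))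
    {P : Set (EuclideanSpace ℝ (Fin n))} (hP : IsCone P) :
    coneParity (g '' P) = coneParity P := by
  have h : eulerMod (g '' P) = eulerMod P :=
    eulerMod_image (A := g.toLinearEquiv.toLinearMap) hP.isConstructible g.injective.injOn
  rcases P.eq_empty_or_nonempty with rfl | hne
  · rw [Set.image_empty]
  · rw [coneParity_of_nonempty hne, coneParity_of_nonempty (hne.image g), h]

/-- The homomorphism from `L_n` that detects the half-line. -/
noncomputable def parityHom (n : ℕ) : LGroup n →+ ZMod 2 :=
  QuotientAddGroup.lift _ (FreeAbelianGroup.lift fun P : ConeIn n => coneParity P.1) (by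
    rw [AddSubgroup.closure_le]
    rintro x ((⟨P, Q, U, N, hU, hN, rfl⟩ | ⟨P, hP, rfl⟩) | ⟨g, P, Q, hQ, rfl⟩)
    · simp only [SetLike.mem_coe, AddMonoidHom.mem_ker, map_sub, map_add,
        FreeAbelianGroup.lift_apply_of, hU, hN]
      rw [← coneParity_union_add_inter P.2 Q.2]
      ring
    · simp only [SetLike.mem_coe, AddMonoidHom.mem_ker, FreeAbelianGroup.lift_apply_of, hP,
        coneParity_empty]
    · simp only [SetLike.mem_coe, AddMonoidHom.mem_ker, map_sub, FreeAbelianGroup.lift_apply_of,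
        hQ]
      exact sub_eq_zero.2 (coneParity_image g P.2))

theorem parityHom_coneClass {n : ℕ} {P : Set (EuclideanSpace ℝ (Fin n))} (hP : IsCone P) :
    parityHom n (coneClass P hP) = coneParity P :=
  FreeAbelianGroup.lift_apply_of _ _

/-- The relatively open face of the orthant. -/
def openOrthant {ι : Type*} (s : Finset ι) : Set (ι → ℝ) :=
  {x | (∀ i ∈ s, 0 < x i) ∧ ∀ i, i ∉ s → x i = 0}

theorem isUnionOfCells_openOrthant {ι : Type*} [Fintype ι] (s : Finset ι) :
    IsUnionOfCells (Finset.univ.toList.map fun i : ι => LinearMap.proj i) (openOrthant s) := by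
  intro x y hxy hx
  have hs : ∀ i, SignType.sign (x i) = SignType.sign (y i) := fun i =>
    signPattern_eq_iff.1 hxy (LinearMap.proj i) (List.mem_map.2 ⟨i, by simp, rfl⟩)
  refine ⟨fun i hi => ?_, fun i hi => ?_⟩
  · rw [← sign_eq_one_iff, ← hs i, sign_eq_one_iff]
    exact hx.1 i hi
  · rw [← sign_eq_zero_iff, ← hs i, sign_eq_zero_iff]
    exact hx.2 i hi

theorem isConstructible_openOrthant {ι : Type*} [Fintype ι] (s : Finset ι) :
    IsConstructible (openOrthant s) := ⟨_, isUnionOfCells_openOrthant s⟩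

theorem eulerMod_openOrthant {ι : Type*} [Fintype ι] (s : Finset ι) :
    eulerMod (openOrthant s) = 1 := by
  classical
  rw [eulerMod_eq (isUnionOfCells_openOrthant s), cellCount]
  set F : List ((ι → ℝ) →ₗ[ℝ] ℝ) := Finset.univ.toList.map fun i : ι => LinearMap.proj i
  have hmem : (fun i => if i ∈ s then (1 : ℝ) else 0) ∈ openOrthant s :=
    ⟨fun i hi => by simp [hi], fun i hi => by simp [hi]⟩
  have : signPattern F '' openOrthant s =
      {signPattern F (fun i => if i ∈ s then (1 : ℝ) else 0)} := by
    refine Set.eq_singleton_iff_unique_mem.2 ⟨⟨_, hmem, rfl⟩, ?_⟩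
    rintro _ ⟨x, hx, rfl⟩
    refine signPattern_eq_iff.2 fun h hh => ?_
    obtain ⟨i, _, rfl⟩ := List.mem_map.1 hh
    by_cases hi : i ∈ s
    · simp [hi, hx.1 i hi]
    · simp [hi, hx.2 i hi]
  rw [this, Set.ncard_singleton, Nat.cast_one]

/-- The interior of the simplex is an injective linear image of an open orthant, a single cell. -/
theorem eulerMod_conic {E : Type*} [AddCommGroup E] [Module ℝ E] [FiniteDimensional ℝ E]
    {ι : Type*} [Fintype ι] [DecidableEq ι] {v : ι → E} {s : Finset ι}
    (hv : LinearIndepOn ℝ v (s : Set ι)) :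
    eulerMod (conic v s) = eulerMod (⋃ i ∈ s, conic v (s.erase i)) + 1 := by
  set A := Fintype.linearCombination ℝ v with hA
  rw [linearIndepOn_finset_iffₛ] at hv
  have hAx : ∀ x ∈ openOrthant s, A x = ∑ i ∈ s, x i • v i := by
    intro x hx
    rw [Fintype.linearCombination_apply]
    exact (Finset.sum_subset (Finset.subset_univ s) fun i _ hi => by
      rw [hx.2 i hi, zero_smul]).symm
  have hinj : Set.InjOn A (openOrthant s) := by
    intro x hx y hy hxy
    rw [hAx x hx, hAx y hy] at hxy
    funext i
    by_cases hi : i ∈ s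
    · exact hv _ _ hxy i hi
    · rw [hx.2 i hi, hy.2 i hi]
  have hunion : conic v s = (⋃ i ∈ s, conic v (s.erase i)) ∪ A '' openOrthant s := by
    apply Set.Subset.antisymm
    · intro x hx
      obtain ⟨c, hc, rfl⟩ := mem_conic.1 hx
      by_cases h : ∃ i ∈ s, c i = 0
      · obtain ⟨i, hi, hci⟩ := h
        refine Or.inl (Set.mem_biUnion hi (mem_conic.2
          ⟨c, fun l hl => hc l (Finset.mem_of_mem_erase hl), Finset.sum_erase s ?_⟩))
        rw [hci, zero_smul]
      · push Not at h
        have hmem : (fun i => if i ∈ s then c i else 0) ∈ openOrthant s :=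
          ⟨fun i hi => by simpa [hi] using (hc i hi).lt_of_ne' (h i hi), fun i hi => by simp [hi]⟩
        refine Or.inr ⟨_, hmem, ?_⟩
        rw [hAx _ hmem]
        exact Finset.sum_congr rfl fun i hi => by simp [hi]
    · refine Set.union_subset (Set.iUnion₂_subset fun i _ => conic_mono (Finset.erase_subset _ _))
        ?_
      rintro _ ⟨x, hx, rfl⟩
      rw [hAx x hx]
      exact mem_conic.2 ⟨x, fun i hi => (hx.1 i hi).le, rfl⟩
  have hdisj : (⋃ i ∈ s, conic v (s.erase i)) ∩ A '' openOrthant s = ∅ := by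
    rw [← Set.disjoint_iff_inter_eq_empty, Set.disjoint_left]
    rintro y hy ⟨x, hx, rfl⟩
    obtain ⟨i, hi, hy⟩ := Set.mem_iUnion₂.1 hy
    obtain ⟨c, _, hcx⟩ := mem_conic.1 hy
    rw [hAx x hx] at hcx
    have := hv (fun l => if l = i then 0 else c l) x (by
      rw [← hcx, ← Finset.add_sum_erase s _ hi]
      simp only [if_true, zero_smul, zero_add]
      exact Finset.sum_congr rfl fun l hl => by rw [if_neg (Finset.ne_of_mem_erase hl)]) i hi
    simp only [if_true] at this
    exact (hx.1 i hi).ne this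
  have hb : IsConstructible (⋃ i ∈ s, conic v (s.erase i)) :=
    isConstructible_biUnion s fun i _ => (isCone_conic v _).isConstructible
  have h := eulerMod_union_add_inter hb ((isConstructible_openOrthant s).image hinj)
  rwa [hdisj, eulerMod_empty, add_zero, ← hunion,
    eulerMod_image (isConstructible_openOrthant s) hinj, eulerMod_openOrthant] at h

theorem EuclideanCone.eulerMod_carrier {n : ℕ} (C : EuclideanCone n) :
    eulerMod C.carrier = (C.faces.card : ZMod 2) := by
  have h : C.carrier = ⋃ s ∈ C.faces, openOrthant s := by
    ext x
    simp only [Set.mem_iUnion, exists_prop]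
    constructor
    · rintro ⟨h0, s, hs, hx⟩
      refine ⟨s.filter fun i => 0 < x i, C.down_closed s hs _ (Finset.filter_subset _ _),
        fun i hi => (Finset.mem_filter.1 hi).2, fun i hi => ?_⟩
      by_contra hne
      have hpos := (h0 i).lt_of_ne' hne
      exact hi (Finset.mem_filter.2 ⟨by_contra fun his => hne (hx i his), hpos⟩)
    · rintro ⟨s, hs, hx⟩
      refine ⟨fun i => ?_, s, hs, hx.2⟩
      by_cases hi : i ∈ s
      · exact (hx.1 i hi).le
      · exact (hx.2 i hi).ge
  rw [h, eulerMod_biUnion C.faces fun s _ => isConstructible_openOrthant s]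
  · simp [eulerMod_openOrthant]
  · intro s _ t _ hst
    refine Set.disjoint_left.2 fun x hs ht => hst ?_
    ext i
    constructor
    · intro hi
      by_contra hi'
      exact (hs.1 i hi).ne' (ht.2 i hi')
    · intro hi
      by_contra hi'
      exact (ht.1 i hi).ne' (hs.2 i hi')

/-- Invariance under piecewise linear injections: the equivalence in `h` says both that the maps
agree on overlaps and that together they are injective. Inclusion–exclusion then reduces to one
linear map at a time. -/
theorem eulerMod_biUnion_image {E E' κ : Type*} [AddCommGroup E] [Module ℝ E] [AddCommGroup E']
    [Module ℝ E'] [FiniteDimensional ℝ E'] (t : Finset κ) {Q : κ → Set E}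
    {A : κ → E →ₗ[ℝ] E'} (hQ : ∀ i ∈ t, IsConstructible (Q i))
    (h : ∀ i ∈ t, ∀ j ∈ t, ∀ x ∈ Q i, ∀ y ∈ Q j, A i x = A j y ↔ x = y) :
    eulerMod (⋃ i ∈ t, A i '' Q i) = eulerMod (⋃ i ∈ t, Q i) := by
  classical
  induction t using Finset.induction_on with
  | empty => simp [eulerMod_empty]
  | insert a t ha ih =>
    have hmem := fun i (hi : i ∈ t) => Finset.mem_insert_of_mem (b := a) hi
    have haa := Finset.mem_insert_self a t
    have hinj : ∀ i ∈ insert a t, Set.InjOn (A i) (Q i) := fun i hi x hx y hy hxy =>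
      (h i hi i hi x hx y hy).1 hxy
    rw [Finset.set_biUnion_insert, Finset.set_biUnion_insert]
    have hU : IsConstructible (⋃ i ∈ t, Q i) := isConstructible_biUnion t fun i hi => hQ i (hmem i hi)
    have hV : IsConstructible (⋃ i ∈ t, A i '' Q i) :=
      isConstructible_biUnion t fun i hi => (hQ i (hmem i hi)).image (hinj i (hmem i hi))
    have hint : A a '' Q a ∩ ⋃ i ∈ t, A i '' Q i = A a '' (Q a ∩ ⋃ i ∈ t, Q i) := by
      ext z
      simp only [Set.mem_inter_iff, Set.mem_iUnion, exists_prop, Set.mem_image]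
      constructor
      · rintro ⟨⟨x, hx, rfl⟩, i, hi, y, hy, hxy⟩
        obtain rfl := (h i (hmem i hi) a haa y hy x hx).1 hxy
        exact ⟨y, ⟨hx, i, hi, hy⟩, rfl⟩
      · rintro ⟨x, ⟨hx, i, hi, hy⟩, rfl⟩
        exact ⟨⟨x, hx, rfl⟩, i, hi, x, hy, (h i (hmem i hi) a haa x hy x hx).2 rfl⟩
    have h1 := eulerMod_union_add_inter (hQ a haa) hU
    have h2 := eulerMod_union_add_inter ((hQ a haa).image (hinj a haa)) hV
    rw [hint, eulerMod_image (hQ a haa) (hinj a haa),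
      eulerMod_image ((hQ a haa).inter hU) ((hinj a haa).mono Set.inter_subset_left),
      ih (fun i hi => hQ i (hmem i hi)) (fun i hi j hj => h i (hmem i hi) j (hmem j hj))] at h2
    linear_combination h2 - h1

/-- A polytope containing 0 agrees, along each ray near 0, with the cone generated by its vertices;
thus cones can replace the chart's pieces at the apex. -/
theorem exists_forall_smul_mem_convexHull {E : Type*} [AddCommGroup E] [Module ℝ E] {s : Set E}
    (h0 : (0 : E) ∈ convexHull ℝ s) {x : E} (hx : x ∈ PointedCone.hull ℝ s) :
    ∃ ε : ℝ, 0 < ε ∧ ∀ δ : ℝ, 0 < δ → δ ≤ ε → δ • x ∈ convexHull ℝ s := by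
  have hconv := convex_convexHull ℝ s
  induction hx using Submodule.span_induction with
  | mem x hx =>
    refine ⟨1, one_pos, fun δ hδ hδ1 => ?_⟩
    exact hconv.smul_mem_of_zero_mem h0 (subset_convexHull ℝ s hx) ⟨hδ.le, hδ1⟩
  | zero => exact ⟨1, one_pos, fun δ _ _ => by rwa [smul_zero]⟩
  | add x y _ _ hx hy =>
    obtain ⟨ε, hε, hx⟩ := hx
    obtain ⟨ε', hε', hy⟩ := hy
    refine ⟨min ε ε' / 2, by positivity, fun δ hδ hδ1 => ?_⟩
    have h1 := hx (2 * δ) (by positivity) (by linarith [min_le_left ε ε'])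
    have h2 := hy (2 * δ) (by positivity) (by linarith [min_le_right ε ε'])
    convert hconv h1 h2 (a := 1 / 2) (b := 1 / 2) (by norm_num) (by norm_num) (by norm_num) using 1
    rw [smul_smul, smul_smul, smul_add]
    rw [show 1 / 2 * (2 * δ) = δ by ring]
  | smul r x _ hx =>
    obtain ⟨ε, hε, hx⟩ := hx
    have hr : 0 ≤ (r : ℝ) := r.2
    refine ⟨ε / (r + 1), by positivity, fun δ hδ hδ1 => ?_⟩
    have hrx : r • x = (r : ℝ) • x := rfl
    rw [hrx, smul_smul]
    rcases hr.eq_or_lt with h | h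
    · rwa [← h, mul_zero, zero_smul]
    · refine hx _ (by positivity) ?_
      rw [le_div_iff₀ (by positivity)] at hδ1
      nlinarith

/-- A PL chart at the apex shows that a manifold cone has odd Euler characteristic. -/
theorem eulerMod_eq_one_of_chart {k m : ℕ} {K N : Set (Fin k → ℝ)}
    (hK : ∀ x ∈ K, ∀ r : ℝ, 0 < r → r • x ∈ K) (h0K : (0 : Fin k → ℝ) ∈ K) (hNK : N ⊆ K)
    (hN : N ∈ 𝓝[K] 0) {f : (Fin k → ℝ) → (Fin m → ℝ)} (hf : IsPLOnPolytope f N)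
    (hinj : Set.InjOn f N) (himg : f '' N ∈ 𝓝 (f 0)) : eulerMod K = 1 := by
  classical
  obtain ⟨S, hS, hNS, hpieces⟩ := hf
  have h0N : (0 : Fin k → ℝ) ∈ N := mem_of_mem_nhdsWithin h0K hN
  have hsub : ∀ P ∈ S, P ⊆ N := fun P hP => hNS ▸ Set.subset_sUnion_of_mem hP
  choose! hvert a ha using hpieces
  choose! V hVfin hV using hvert
  have hclosed : ∀ P ∈ S, IsClosed P := fun P hP => by
    rw [hV P hP]
    exact (hVfin P hP).isClosed_convexHull ℝ
  have hcompact : ∀ P ∈ S, IsCompact P := fun P hP => by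
    rw [hV P hP]
    exact (hVfin P hP).isCompact_convexHull ℝ
  have hfar : ∀ᶠ x in 𝓝 (0 : Fin k → ℝ), ∀ P ∈ {P | P ∈ S ∧ (0 : Fin k → ℝ) ∉ P}, x ∉ P := by
    rw [Filter.eventually_all_finite (hS.subset fun P hP => hP.1)]
    rintro P ⟨hP, h0⟩
    exact (hclosed P hP).isOpen_compl.mem_nhds h0
  -- Pieces off the apex have compact images that miss f 0 by injectivity, so near the apex only the
  -- pieces in `J` matter, in the source and in the target.
  have hfar' : ∀ᶠ z in 𝓝 (f 0), ∀ P ∈ {P | P ∈ S ∧ (0 : Fin k → ℝ) ∉ P}, z ∉ f '' P := by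
    rw [Filter.eventually_all_finite (hS.subset fun P hP => hP.1)]
    rintro P ⟨hP, h0⟩
    have hc : IsClosed (f '' P) := by
      rw [(ha P hP).image_eq]
      exact ((hcompact P hP).image (AffineMap.continuous_of_finiteDimensional _)).isClosed
    refine hc.isOpen_compl.mem_nhds ?_
    rintro ⟨y, hy, hy0⟩
    exact h0 (hinj (hsub P hP hy) h0N hy0 ▸ hy)
  set J : Finset (Set (Fin k → ℝ)) := hS.toFinset.filter fun P => (0 : Fin k → ℝ) ∈ P with hJ
  have hJmem : ∀ P, P ∈ J ↔ P ∈ S ∧ (0 : Fin k → ℝ) ∈ P := by simp [hJ]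
  set Q : Set (Fin k → ℝ) → Set (Fin k → ℝ) := fun P => (PointedCone.hull ℝ (V P) : Set _) with hQ
  set A : Set (Fin k → ℝ) → (Fin k → ℝ) →ₗ[ℝ] (Fin m → ℝ) := fun P => (a P).linear with hA
  have hsmall : ∀ P ∈ J, ∀ x ∈ Q P, ∀ᶠ δ : ℝ in 𝓝[>] 0, δ • x ∈ P := by
    intro P hP x hx
    obtain ⟨hPS, h0⟩ := (hJmem P).1 hP
    rw [hV P hPS] at h0
    obtain ⟨ε, hε, h⟩ := exists_forall_smul_mem_convexHull h0 hx
    filter_upwards [Ioc_mem_nhdsGT hε] with δ hδ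
    rw [hV P hPS]
    exact h δ hδ.1 hδ.2
  have hval : ∀ P ∈ J, ∀ x ∈ P, f x = A P x + f 0 := by
    intro P hP x hx
    obtain ⟨hPS, h0⟩ := (hJmem P).1 hP
    rw [ha P hPS hx, ha P hPS h0]
    have := congrFun (AffineMap.decomp (a P)) x
    simpa using this
  have hPQ : ∀ P ∈ J, P ⊆ Q P := by
    intro P hP
    have hPS := ((hJmem P).1 hP).1
    conv_lhs => rw [hV P hPS]
    exact convexHull_min PointedCone.subset_hull (PointedCone.convex _)
  have hQsmul : ∀ P, ∀ x ∈ Q P, ∀ r : ℝ, 0 ≤ r → r • x ∈ Q P := fun P x hx r hr =>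
    PointedCone.smul_mem _ hr hx
  have hKQ : K = ⋃ P ∈ J, Q P := by
    ext x
    simp only [Set.mem_iUnion, exists_prop]
    constructor
    · intro hx
      have htend : Filter.Tendsto (fun δ : ℝ => δ • x) (𝓝[>] 0) (𝓝[K] 0) := by
        refine tendsto_nhdsWithin_iff.2 ⟨?_, ?_⟩
        · have : Filter.Tendsto (fun δ : ℝ => δ • x) (𝓝 0) (𝓝 ((0 : ℝ) • x)) :=
            (continuous_id.smul continuous_const).tendsto 0
          rw [zero_smul] at this
          exact this.mono_left nhdsWithin_le_nhds
        · filter_upwards [self_mem_nhdsWithin] with δ hδ using hK x hx δ hδ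
      obtain ⟨δ, ⟨h1, h2⟩, hδ⟩ := (((htend.eventually hN).and (htend.eventually
        (nhdsWithin_le_nhds hfar))).and self_mem_nhdsWithin).exists
      have hδ : 0 < δ := hδ
      have h1 : δ • x ∈ N := h1
      rw [hNS] at h1
      obtain ⟨P, hP, hxP⟩ := h1
      have hPJ : P ∈ J := (hJmem P).2 ⟨hP, by_contra fun h => h2 P ⟨hP, h⟩ hxP⟩
      refine ⟨P, hPJ, ?_⟩
      have := hQsmul P _ (hPQ P hPJ hxP) δ⁻¹ (by positivity)
      rwa [smul_smul, inv_mul_cancel₀ hδ.ne', one_smul] at this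
    · rintro ⟨P, hP, hx⟩
      obtain ⟨δ, h1, hδ⟩ := ((hsmall P hP x hx).and self_mem_nhdsWithin).exists
      have hδ : 0 < δ := hδ
      have := hK _ (hNK (hsub P ((hJmem P).1 hP).1 h1)) δ⁻¹ (by positivity)
      rwa [smul_smul, inv_mul_cancel₀ hδ.ne', one_smul] at this
  -- Shrink both points into their polytopes, use that f is a single injective map there, and scale
  -- back.
  have hiff : ∀ i ∈ J, ∀ j ∈ J, ∀ x ∈ Q i, ∀ y ∈ Q j, A i x = A j y ↔ x = y := by
    intro i hi j hj x hx y hy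
    obtain ⟨δ, ⟨h1, h2⟩, hδ⟩ :=
      (((hsmall i hi x hx).and (hsmall j hj y hy)).and self_mem_nhdsWithin).exists
    have hδ : 0 < δ := hδ
    have e1 := hval i hi _ h1
    have e2 := hval j hj _ h2
    rw [map_smul] at e1 e2
    constructor
    · intro hxy
      have : δ • x = δ • y := hinj (hsub i ((hJmem i).1 hi).1 h1) (hsub j ((hJmem j).1 hj).1 h2)
        (by rw [e1, e2, hxy])
      exact smul_right_injective _ hδ.ne' this
    · rintro rfl
      rw [e1] at e2
      exact smul_right_injective _ hδ.ne' (add_right_cancel e2)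
  -- Every vector of ℝ^m, shrunk and translated to f 0, lands in the image of the chart.
  have hsurj : ⋃ P ∈ J, A P '' Q P = Set.univ := by
    refine Set.eq_univ_of_forall fun z => ?_
    have htend : Filter.Tendsto (fun δ : ℝ => δ • z + f 0) (𝓝[>] 0) (𝓝 (f 0)) := by
      have : Filter.Tendsto (fun δ : ℝ => δ • z + f 0) (𝓝 0) (𝓝 ((0 : ℝ) • z + f 0)) :=
        ((continuous_id.smul continuous_const).add continuous_const).tendsto 0
      rw [zero_smul, zero_add] at this
      exact this.mono_left nhdsWithin_le_nhds
    obtain ⟨δ, ⟨⟨y, hyN, hy⟩, h2⟩, hδ⟩ := (((htend.eventually himg).and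
      (htend.eventually hfar')).and self_mem_nhdsWithin).exists
    have hδ : 0 < δ := hδ
    rw [hNS] at hyN
    obtain ⟨P, hP, hyP⟩ := hyN
    have hPJ : P ∈ J := (hJmem P).2 ⟨hP, by_contra fun h => h2 P ⟨hP, h⟩ ⟨y, hyP, hy⟩⟩
    refine Set.mem_biUnion hPJ ⟨δ⁻¹ • y, hQsmul P _ (hPQ P hPJ hyP) _ (by positivity), ?_⟩
    rw [hval P hPJ y hyP] at hy
    rw [map_smul, add_right_cancel hy, smul_smul, inv_mul_cancel₀ hδ.ne', one_smul]
  rw [hKQ, ← eulerMod_biUnion_image J (A := A) _ hiff, hsurj, eulerMod_univ]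
  intro P hP
  exact (isCone_hull (hVfin P ((hJmem P).1 hP).1)).isConstructible

/-- Every face contributes 1 through its open cell. The nonemptiness terms of σ and ∂σ cancel except
at the apex, which adds one more 1 to the odd number of faces. -/
theorem parityHom_toL_eq_zero {n m : ℕ} (C : EuclideanCone n) (hC : C.IsInteriorManifold m) :
    parityHom n C.toL = 0 := by
  obtain ⟨⟨x₀, hx₀, s₀, hs₀, _⟩, hM⟩ := hC
  have hempty : ∅ ∈ C.faces := C.down_closed s₀ hs₀ ∅ (Finset.empty_subset _)
  have h0 : (0 : Fin C.k → ℝ) ∈ C.carrier := ⟨fun _ => le_rfl, s₀, hs₀, fun _ _ => rfl⟩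
  obtain ⟨N, hNK, hN, f, hf, hinj, himg⟩ := hM 0 h0
  have hcard : (C.faces.card : ZMod 2) = 1 := by
    rw [← C.eulerMod_carrier]
    refine eulerMod_eq_one_of_chart ?_ h0 hNK hN hf hinj himg
    rintro x ⟨hx, s, hs, hxs⟩ r hr
    exact ⟨fun i => mul_nonneg hr.le (hx i), s, hs, fun i hi => by simp [hxs i hi]⟩
  have hterm : ∀ s ∈ C.faces, parityHom n (coneClass (C.simplex s) (C.isCone_simplex s) -
      coneClass (C.simplexBoundary s) (C.isCone_simplexBoundary s)) =
        1 + if s = ∅ then 1 else 0 := by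
    intro s hs
    have he : eulerMod (C.simplex s) = eulerMod (C.simplexBoundary s) + 1 :=
      eulerMod_conic (C.linearIndependent s hs)
    have h1 : (C.simplex s).Nonempty := ⟨0, Submodule.zero_mem _⟩
    rw [map_sub, parityHom_coneClass, parityHom_coneClass, coneParity_of_nonempty h1, he]
    by_cases hs0 : s = ∅
    · subst hs0
      have : C.simplexBoundary ∅ = ∅ := by simp [EuclideanCone.simplexBoundary]
      rw [this, coneParity_empty, eulerMod_empty, if_pos rfl]
      decide
    · obtain ⟨i, hi⟩ := Finset.nonempty_iff_ne_empty.2 hs0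
      have h2 : (C.simplexBoundary s).Nonempty :=
        ⟨0, Set.mem_biUnion hi (Submodule.zero_mem _)⟩
      rw [coneParity_of_nonempty h2, if_neg hs0]
      ring
  rw [EuclideanCone.toL, map_sum, Finset.sum_congr rfl hterm, Finset.sum_add_distrib,
    Finset.sum_ite_eq' C.faces ∅, if_pos hempty]
  simp only [Finset.sum_const, nsmul_eq_mul, mul_one, hcard]
  decide

theorem parityHom_conicClass_of_card_eq_one {n : ℕ} {ι : Type} [Fintype ι]
    {v : ι → EuclideanSpace ℝ (Fin n)} {i : ι} (hv : v i ≠ 0) :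
    parityHom n (conicClass v {i}) = 1 := by
  classical
  have hv' : LinearIndepOn ℝ v (({i} : Finset ι) : Set ι) := by simpa using hv
  have h1 := eulerMod_conic hv'
  have h2 := eulerMod_conic (v := v) (s := ∅) (by simp)
  simp only [Finset.mem_singleton, Set.iUnion_iUnion_eq_left, Finset.erase_singleton] at h1
  simp only [Finset.notMem_empty, Set.iUnion_of_empty, Set.iUnion_empty, eulerMod_empty] at h2
  have h3 : (conic v {i}).Nonempty := ⟨0, Submodule.zero_mem _⟩
  rw [conicClass, parityHom_coneClass, coneParity_of_nonempty h3, h1, h2]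
  decide

end Parity

/-! ### The cross-polytope cones -/

section CrossPolytope

variable {n d : ℕ}

theorem conic_comp {E ι κ : Type*} [AddCommGroup E] [Module ℝ E] [DecidableEq κ] (v : κ → E)
    (p : ι → κ) (s : Finset ι) : conic (v ∘ p) s = conic v (s.image p) := by
  rw [conic, conic, Set.image_comp, Finset.coe_image]

theorem conicClass_eq_of_conic_eq {ι κ : Type*} {v : ι → EuclideanSpace ℝ (Fin n)} {s : Finset ι}
    {w : κ → EuclideanSpace ℝ (Fin n)} {t : Finset κ} (h : conic v s = conic w t) :
    conicClass v s = conicClass w t :=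
  coneClass_congr h _ _

/-- The vertices of the cross-polytope in pairs of opposite ones. -/
def crossEquiv (d : ℕ) : Fin d × Fin 2 ≃ Fin (d * 2) := finProdFinEquiv

/-- The vertex of the simplex that a vertex of the cross-polytope is folded onto. -/
def crossFold (i : Fin (d * 2)) : Fin d := ((crossEquiv d).symm i).1

open Classical in
/-- The cone over the boundary of the cross-polytope, all of whose facets are copies of the
simplex spanned by `v`. -/
noncomputable def crossCone {v : Fin d → EuclideanSpace ℝ (Fin n)} (hv : LinearIndependent ℝ v) :
    EuclideanCone n where
  k := d * 2
  faces := Finset.univ.filter fun s => Set.InjOn crossFold (s : Set (Fin (d * 2)))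
  down_closed s hs t ht := by
    simp only [Finset.mem_filter, Finset.mem_univ, true_and] at hs ⊢
    exact hs.mono ht
  emb _ i := v (crossFold i)
  linearIndependent s hs := by
    simp only [Finset.mem_filter, Finset.mem_univ, true_and] at hs
    exact hv.comp (fun i : s => crossFold i) fun i j hij => Subtype.ext (hs i.2 j.2 hij)
  compatible _ _ _ _ _ _ _ _ := rfl

theorem mem_faces_crossCone {v : Fin d → EuclideanSpace ℝ (Fin n)} (hv : LinearIndependent ℝ v)
    (s : Finset (Fin (d * 2))) :
    s ∈ (crossCone hv).faces ↔ Set.InjOn crossFold (s : Set (Fin (d * 2))) := by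
  classical
  exact Finset.mem_filter.trans (by simp)

open Classical in
-- A facet picks one vertex from each of the d opposite pairs.
theorem card_facets_crossCone :
    (Finset.univ.filter fun s : Finset (Fin (d * 2)) =>
      Set.InjOn crossFold (s : Set (Fin (d * 2))) ∧ s.card = d).card = 2 ^ d := by
  have h2 : (Finset.univ : Finset (Fin d → Fin 2)).card = 2 ^ d := by simp
  rw [← h2]
  symm
  have hinj : ∀ ε : Fin d → Fin 2,
      Function.Injective fun a : Fin d => crossEquiv d (a, ε a) := by
    intro ε a b hab
    exact (Prod.ext_iff.1 ((crossEquiv d).injective hab)).1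
  refine Finset.card_bij (fun ε _ => Finset.univ.image fun a => crossEquiv d (a, ε a)) ?_ ?_ ?_
  · intro ε _
    simp only [Finset.mem_filter, Finset.mem_univ, true_and]
    refine ⟨?_, by rw [Finset.card_image_of_injective _ (hinj ε)]; simp⟩
    intro i hi j hj hij
    simp only [Finset.coe_image, Finset.coe_univ, Set.image_univ, Set.mem_range] at hi hj
    obtain ⟨a, rfl⟩ := hi
    obtain ⟨b, rfl⟩ := hj
    simp only [crossFold, Equiv.symm_apply_apply] at hij
    rw [hij]
  · intro ε _ ε' _ h
    funext a
    have : crossEquiv d (a, ε a) ∈ Finset.univ.image fun a => crossEquiv d (a, ε' a) := by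
      rw [← h]
      exact Finset.mem_image_of_mem _ (Finset.mem_univ a)
    obtain ⟨b, _, hb⟩ := Finset.mem_image.1 this
    have hb := Prod.ext_iff.1 ((crossEquiv d).injective hb)
    obtain ⟨rfl, h2⟩ := hb
    exact h2.symm
  · intro s hs
    simp only [Finset.mem_filter, Finset.mem_univ, true_and] at hs
    obtain ⟨hs, hcard⟩ := hs
    have himg : s.image crossFold = Finset.univ := by
      rw [← Finset.card_eq_iff_eq_univ, Finset.card_image_of_injOn hs, hcard, Fintype.card_fin]
    have hex : ∀ a : Fin d, ∃ i ∈ s, crossFold i = a := fun a =>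
      Finset.mem_image.1 (himg ▸ Finset.mem_univ a)
    choose i his hia using hex
    refine ⟨fun a => ((crossEquiv d).symm (i a)).2, Finset.mem_univ _, ?_⟩
    refine Finset.eq_of_subset_of_card_le ?_ ?_
    · intro j hj
      obtain ⟨a, _, rfl⟩ := Finset.mem_image.1 hj
      have : (a, ((crossEquiv d).symm (i a)).2) = (crossEquiv d).symm (i a) :=
        Prod.ext (hia a).symm rfl
      rw [this, Equiv.apply_symm_apply]
      exact his a
    · rw [Finset.card_image_of_injective _ (hinj _), hcard]
      simp

theorem coneClass_boundary_mem {ι : Type} [DecidableEq ι] {v : ι → EuclideanSpace ℝ (Fin n)}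
    {s : Finset ι} (hv : LinearIndepOn ℝ v (s : Set ι)) (hs : s.card ≤ d)
    {K : AddSubgroup (LGroup n)} (hK : ∀ e, e + 1 ≤ d → simplexGroup n e ≤ K)
    (h : IsCone (⋃ i ∈ s, conic v (s.erase i))) :
    coneClass (⋃ i ∈ s, conic v (s.erase i)) h ∈ K := by
  -- For d = 0 there is no smaller dimension to appeal to, but the boundary of the apex is empty and
  -- has class zero.
  rcases d with _ | e
  · obtain rfl := Finset.card_eq_zero.1 (Nat.le_zero.1 hs)
    rw [coneClass_congr (Q := ∅) (by simp) h isCone_empty, coneClass_empty]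
    exact zero_mem _
  · exact hK e le_rfl (coneClass_biUnion_erase_mem hv hs h)

open Classical in
theorem toL_crossCone {v : Fin d → EuclideanSpace ℝ (Fin n)} (hv : LinearIndependent ℝ v) :
    (crossCone hv).toL = ∑ s ∈ Finset.univ.filter fun s : Finset (Fin (d * 2)) =>
        Set.InjOn crossFold (s : Set (Fin (d * 2))),
      (conicClass (v ∘ crossFold) s - coneClass (⋃ i ∈ s, conic (v ∘ crossFold) (s.erase i))
        (IsCone.biUnion s fun _ => isCone_conic _ _)) := by
  unfold EuclideanCone.toL
  refine Finset.sum_congr rfl fun s _ => congrArg₂ _ rfl (coneClass_congr ?_ _ _)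
  refine Set.iUnion₂_congr fun i _ => ?_
  simp only [conic, Finset.coe_erase]
  congr!
  exact (Finset.coe_erase i s).symm

/-- Folding sends every facet onto the same simplex, so each of the 2^d facets contributes the same
class; all other faces and all boundaries lie in `K`. -/
theorem two_pow_smul_sub_toL_mem {v : Fin d → EuclideanSpace ℝ (Fin n)}
    (hv : LinearIndependent ℝ v) {K : AddSubgroup (LGroup n)}
    (hK : ∀ e, e + 1 ≤ d → simplexGroup n e ≤ K) :
    2 ^ d • conicClass v Finset.univ - (crossCone hv).toL ∈ K := by
  classical
  rw [toL_crossCone, ← card_facets_crossCone, ← Finset.filter_filter, ← Finset.sum_const,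
    Finset.sum_filter, ← Finset.sum_sub_distrib]
  refine K.sum_mem fun s hs => ?_
  have hinj : Set.InjOn crossFold (s : Set (Fin (d * 2))) := (Finset.mem_filter.1 hs).2
  have hli : LinearIndepOn ℝ (v ∘ crossFold) (s : Set (Fin (d * 2))) :=
    hv.comp (fun i : s => crossFold i) fun i j hij => Subtype.ext (hinj i.2 j.2 hij)
  have hcard : s.card ≤ d := by
    rw [← Finset.card_image_of_injOn hinj]
    simpa using Finset.card_le_univ (s.image crossFold)
  rw [← sub_add]
  refine K.add_mem ?_ (coneClass_boundary_mem hli hcard hK _)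
  split_ifs with hsd
  · have himg : s.image crossFold = Finset.univ := by
      rw [← Finset.card_eq_iff_eq_univ, Finset.card_image_of_injOn hinj, hsd, Fintype.card_fin]
    rw [conicClass_eq_of_conic_eq ((conic_comp v crossFold s).trans (by rw [himg])), sub_self]
    exact zero_mem _
  · rw [zero_sub]
    exact K.neg_mem (hK s.card (by omega) (conicClass_mem_simplexGroup hli le_rfl))

theorem setPi_box_eq_convexHull {k : ℕ} (s : Finset (Fin k)) {R : ℝ} (hR : 0 ≤ R) :
    {y : Fin k → ℝ | (∀ i, 0 ≤ y i) ∧ (∀ i, i ∉ s → y i = 0) ∧ ∀ i, y i ≤ R} =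
      convexHull ℝ (Set.univ.pi fun i => if i ∈ s then {0, R} else {0}) := by
  rw [convexHull_pi]
  ext y
  simp only [Set.mem_pi, Set.mem_univ, true_imp_iff]
  constructor
  · rintro ⟨h0, hs, hyR⟩ i
    split_ifs with hi
    · rw [convexHull_pair, segment_eq_Icc hR]
      exact ⟨h0 i, hyR i⟩
    · rw [convexHull_singleton]
      exact hs i hi
  · intro h
    have h' : ∀ i, (i ∈ s → y i ∈ Set.Icc 0 R) ∧ (i ∉ s → y i = 0) := by
      intro i
      have := h i
      split_ifs at this with hi
      · rw [convexHull_pair, segment_eq_Icc hR] at this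
        exact ⟨fun _ => this, fun hn => absurd hi hn⟩
      · rw [convexHull_singleton] at this
        exact ⟨fun hn => absurd hn hi, fun _ => this⟩
    refine ⟨fun i => ?_, fun i => (h' i).2, fun i => ?_⟩
    · by_cases hi : i ∈ s
      · exact ((h' i).1 hi).1
      · exact ((h' i).2 hi).ge
    · by_cases hi : i ∈ s
      · exact ((h' i).1 hi).2
      · exact ((h' i).2 hi).le.trans hR

/-- The underlying space of the cross-polytope cone. -/
def crossCarrier (d : ℕ) : Set (Fin (d * 2) → ℝ) :=
  {x | (∀ i, 0 ≤ x i) ∧ ∃ s : Finset (Fin (d * 2)),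
    Set.InjOn crossFold (s : Set (Fin (d * 2))) ∧ ∀ i, i ∉ s → x i = 0}

theorem carrier_crossCone {v : Fin d → EuclideanSpace ℝ (Fin n)} (hv : LinearIndependent ℝ v) :
    (crossCone hv).carrier = crossCarrier d := by
  refine Set.ext fun x => and_congr_right fun _ => exists_congr fun s => and_congr_left fun _ => ?_
  exact mem_faces_crossCone hv s

/-- The chart of the cross-polytope cone. -/
def crossChart (d : ℕ) : (Fin (d * 2) → ℝ) →ₗ[ℝ] (Fin d → ℝ) :=
  LinearMap.pi fun a => LinearMap.proj (R := ℝ) (φ := fun _ => ℝ) (crossEquiv d (a, 0)) -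
    LinearMap.proj (R := ℝ) (φ := fun _ => ℝ) (crossEquiv d (a, 1))

theorem crossChart_apply (x : Fin (d * 2) → ℝ) (a : Fin d) :
    crossChart d x a = x (crossEquiv d (a, 0)) - x (crossEquiv d (a, 1)) := rfl

/-- On the carrier the coordinates of an opposite pair are nonnegative and at most one is nonzero,
so they are the positive and negative parts of their difference. -/
theorem injOn_crossChart : Set.InjOn (crossChart d) (crossCarrier d) := by
  have key : ∀ x ∈ crossCarrier d, ∀ a : Fin d,
      x (crossEquiv d (a, 0)) = 0 ∨ x (crossEquiv d (a, 1)) = 0 := by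
    rintro x ⟨_, s, hinj, hx⟩ a
    by_contra! hcon
    have h0 : crossEquiv d (a, 0) ∈ s := by_contra fun h => hcon.1 (hx _ h)
    have h1 : crossEquiv d (a, 1) ∈ s := by_contra fun h => hcon.2 (hx _ h)
    have := hinj h0 h1 (by simp [crossFold])
    simpa using (crossEquiv d).injective this
  intro x hx y hy hxy
  have h : ∀ a, x (crossEquiv d (a, 0)) = y (crossEquiv d (a, 0)) ∧
      x (crossEquiv d (a, 1)) = y (crossEquiv d (a, 1)) := by
    intro a
    have h1 := congrFun hxy a
    rw [crossChart_apply, crossChart_apply] at h1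
    have hx0 := hx.1 (crossEquiv d (a, 0))
    have hx1 := hx.1 (crossEquiv d (a, 1))
    have hy0 := hy.1 (crossEquiv d (a, 0))
    have hy1 := hy.1 (crossEquiv d (a, 1))
    rcases key x hx a with h2 | h2 <;> rcases key y hy a with h3 | h3 <;>
      constructor <;> linarith
  funext i
  obtain ⟨⟨a, b⟩, rfl⟩ := (crossEquiv d).surjective i
  fin_cases b
  · exact (h a).1
  · exact (h a).2

/-- The chart is global; truncating by a bound R on the coordinates only serves to obtain compact
neighbourhoods, composed of boxes. -/
theorem isPLManifold_crossCarrier : IsPLManifoldWithoutBoundary d (crossCarrier d) := by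
  classical
  intro x hx
  set R : ℝ := ‖x‖ + 1 with hRdef
  have hR : 0 ≤ R := by positivity
  have hxR : ∀ i, x i < R := fun i => by
    have := (le_abs_self (x i)).trans (norm_le_pi_norm x i)
    linarith
  let N : Set (Fin (d * 2) → ℝ) := {y | y ∈ crossCarrier d ∧ ∀ i, y i ≤ R}
  refine ⟨N, fun y hy => hy.1, ?_, crossChart d, ?_, ?_, ?_⟩
  · have hopen : IsOpen {y : Fin (d * 2) → ℝ | ∀ i, y i < R} := by
      simp only [Set.ofPred_forall]
      exact isOpen_iInter_of_finite fun i => isOpen_lt (continuous_apply i) continuous_const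
    exact mem_nhdsWithin.2 ⟨_, hopen, hxR, fun y hy => ⟨hy.2, fun i => (hy.1 i).le⟩⟩
  · refine ⟨(fun s : Finset (Fin (d * 2)) => {y : Fin (d * 2) → ℝ | (∀ i, 0 ≤ y i) ∧
      (∀ i, i ∉ s → y i = 0) ∧ ∀ i, y i ≤ R}) '' {s | Set.InjOn crossFold (s : Set (Fin (d * 2)))},
      (Set.toFinite _).image _, ?_, ?_⟩
    · ext y
      simp only [Set.sUnion_image, Set.mem_iUnion, exists_prop]
      constructor
      · rintro ⟨⟨h0, s, hs, hys⟩, hyR⟩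
        exact ⟨s, hs, h0, hys, hyR⟩
      · rintro ⟨s, hs, h0, hys, hyR⟩
        exact ⟨⟨h0, s, hs, hys⟩, hyR⟩
    · rintro _ ⟨s, _, rfl⟩
      refine ⟨⟨Set.univ.pi fun i => if i ∈ s then {0, R} else {0}, Set.Finite.pi fun i => ?_,
        setPi_box_eq_convexHull s hR⟩, (crossChart d).toAffineMap, fun _ _ => rfl⟩
      split_ifs <;> simp
  · exact injOn_crossChart.mono fun y hy => hy.1
  · have hopen : IsOpen {z : Fin d → ℝ | ∀ a, |z a| < R} := by
      simp only [Set.ofPred_forall]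
      exact isOpen_iInter_of_finite fun a =>
        isOpen_lt (continuous_apply a).abs continuous_const
    refine Filter.mem_of_superset (hopen.mem_nhds fun a => ?_) ?_
    · rw [crossChart_apply, abs_lt]
      constructor
      · linarith [hx.1 (crossEquiv d (a, 0)), hxR (crossEquiv d (a, 1))]
      · linarith [hx.1 (crossEquiv d (a, 1)), hxR (crossEquiv d (a, 0))]
    · intro z hz
      -- The preimage of z has the positive and negative parts of z as its paired coordinates.
      let y : Fin (d * 2) → ℝ := fun i =>
        if ((crossEquiv d).symm i).2 = 0 then max (z (crossFold i)) 0
          else max (-z (crossFold i)) 0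
      let s : Finset (Fin (d * 2)) := Finset.univ.filter fun i => 0 < y i
      have hy0 : ∀ a, y (crossEquiv d (a, 0)) = max (z a) 0 := fun a => by
        simp [y, crossFold]
      have hy1 : ∀ a, y (crossEquiv d (a, 1)) = max (-z a) 0 := fun a => by
        simp [y, crossFold]
      have hynn : ∀ i, 0 ≤ y i := fun i => by
        simp only [y]
        split_ifs <;> exact le_max_right _ _
      refine ⟨y, ⟨⟨hynn, s, ?_, fun i hi => ?_⟩, fun i => ?_⟩, ?_⟩
      · intro i hi j hj hij
        have hi : 0 < y i := by simpa [s] using hi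
        have hj : 0 < y j := by simpa [s] using hj
        simp only [y] at hi hj
        rw [← hij] at hj
        have hb : ((crossEquiv d).symm i).2 = ((crossEquiv d).symm j).2 := by
          split_ifs at hi hj with h1 h2 h2
          · rw [h1, h2]
          · rw [lt_max_iff] at hi hj
            simp only [lt_irrefl, or_false] at hi hj
            linarith
          · rw [lt_max_iff] at hi hj
            simp only [lt_irrefl, or_false] at hi hj
            linarith
          · omega
        exact (crossEquiv d).symm.injective (Prod.ext hij hb)
      · by_contra hne
        exact hi (Finset.mem_filter.2 ⟨Finset.mem_univ i, (hynn i).lt_of_ne' hne⟩)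
      · have := abs_lt.1 (hz (crossFold i))
        simp only [y]
        split_ifs <;> exact max_le (by linarith) hR
      · funext a
        rw [crossChart_apply, hy0, hy1, max_zero_sub_max_neg_zero_eq_self]

theorem isInteriorManifold_crossCone {v : Fin d → EuclideanSpace ℝ (Fin n)}
    (hv : LinearIndependent ℝ v) : (crossCone hv).IsInteriorManifold d := by
  refine ⟨?_, ?_⟩
  · rw [carrier_crossCone hv]
    exact ⟨0, fun _ => le_rfl, ∅, by simp, fun _ _ => rfl⟩
  · rw [carrier_crossCone hv]
    exact isPLManifold_crossCarrier

theorem toL_crossCone_mem {v : Fin d → EuclideanSpace ℝ (Fin n)} (hv : LinearIndependent ℝ v) :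
    (crossCone hv).toL ∈ Lev n ⊔ Lod n := by
  rcases Nat.even_or_odd d with hd | hd
  · exact AddSubgroup.mem_sup_left (AddSubgroup.subset_closure
      ⟨_, d, hd, isInteriorManifold_crossCone hv, rfl⟩)
  · exact AddSubgroup.mem_sup_right (AddSubgroup.subset_closure
      ⟨_, d, hd, isInteriorManifold_crossCone hv, rfl⟩)

theorem conic_univ_equivFin {E ι : Type*} [AddCommGroup E] [Module ℝ E] (v : ι → E)
    (s : Finset ι) : conic (fun k : Fin s.card => v (s.equivFin.symm k)) Finset.univ = conic v s := by
  unfold conic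
  congr 2
  ext x
  constructor
  · rintro ⟨k, _, rfl⟩
    exact ⟨_, (s.equivFin.symm k).2, rfl⟩
  · rintro ⟨i, hi, rfl⟩
    exact ⟨s.equivFin ⟨i, hi⟩, by simp, by simp⟩

/-- A multiple of each simplex is a combination of interior manifold cones and simplices of
smaller dimension. -/
theorem two_pow_smul_conicClass_mem {ι : Type} {v : ι → EuclideanSpace ℝ (Fin n)} {s : Finset ι}
    (hv : LinearIndepOn ℝ v (s : Set ι)) {K : AddSubgroup (LGroup n)} (hM : Lev n ⊔ Lod n ≤ K)
    (hK : ∀ e, e + 1 ≤ s.card → simplexGroup n e ≤ K) : 2 ^ s.card • conicClass v s ∈ K := by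
  have hv' : LinearIndependent ℝ fun k : Fin s.card => v (s.equivFin.symm k) :=
    LinearIndependent.comp (v := fun i : s => v i) hv _ s.equivFin.symm.injective
  have h := K.add_mem (two_pow_smul_sub_toL_mem hv' hK) (hM (toL_crossCone_mem hv'))
  rwa [sub_add_cancel, conicClass_eq_of_conic_eq (conic_univ_equivFin v s)] at h

end CrossPolytope

/-! ### Dissection of a simplex at its incenter -/

section Incenter

variable {n : ℕ} {ι : Type}

/-- The unit inner normals of a simplex, in the span of the simplex. -/
theorem exists_unit_normal {E : Type*} [NormedAddCommGroup E] [InnerProductSpace ℝ E]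
    [FiniteDimensional ℝ E] {v : ι → E} {s : Finset ι} (hv : LinearIndepOn ℝ v (s : Set ι))
    {i : ι} (hi : i ∈ s) :
    ∃ u : E, ‖u‖ = 1 ∧ (∀ j ∈ s, j ≠ i → inner ℝ u (v j) = 0) ∧ 0 < inner ℝ u (v i) ∧
      u ∈ Submodule.span ℝ (v '' (s : Set ι)) := by
  classical
  -- W is the span of the facet opposite to edge i; the normal is v i minus its projection to W,
  -- normalized.
  set W : Submodule ℝ E := Submodule.span ℝ (v '' ((s : Set ι) \ {i})) with hW
  have hnot : v i ∉ W := LinearIndepOn.notMem_span hv hi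
  set q : E := W.starProjection (v i) with hq
  have hqW : q ∈ W := W.starProjection_apply_mem _
  have horth : ∀ w ∈ W, inner ℝ (v i - q) w = 0 := fun w hw =>
    W.starProjection_inner_eq_zero _ w hw
  have hp : v i - q ≠ 0 := fun h => hnot (sub_eq_zero.1 h ▸ hqW)
  have hnorm : 0 < ‖v i - q‖ := norm_pos_iff.2 hp
  refine ⟨‖v i - q‖⁻¹ • (v i - q), ?_, ?_, ?_, ?_⟩
  · rw [norm_smul, norm_inv, norm_norm, inv_mul_cancel₀ hnorm.ne']
  · intro j hj hji
    rw [real_inner_smul_left, horth _ (Submodule.subset_span ⟨j, ⟨hj, hji⟩, rfl⟩), mul_zero]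
  · have h1 : inner ℝ (v i - q) (v i) = inner ℝ (v i - q) (v i - q) := by
      rw [inner_sub_right (v i - q), horth q hqW, sub_zero]
    rw [real_inner_smul_left, h1, real_inner_self_eq_norm_sq]
    positivity
  · refine Submodule.smul_mem _ _ (Submodule.sub_mem _ (Submodule.subset_span ⟨i, hi, rfl⟩) ?_)
    exact Submodule.span_mono (Set.image_mono Set.sdiff_subset) hqW

/-- The normals are, up to positive factors, the dual basis to the edges. -/
theorem sum_coords_eq {E : Type*} [NormedAddCommGroup E] [InnerProductSpace ℝ E] {v u : ι → E}
    {s : Finset ι} (h0 : ∀ i ∈ s, ∀ j ∈ s, j ≠ i → inner ℝ (u i) (v j) = 0)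
    (hpos : ∀ i ∈ s, 0 < inner ℝ (u i) (v i)) {x : E}
    (hx : x ∈ Submodule.span ℝ (v '' (s : Set ι))) :
    ∑ i ∈ s, (inner ℝ (u i) x / inner ℝ (u i) (v i)) • v i = x := by
  classical
  obtain ⟨c, rfl⟩ := Submodule.mem_span_image_finset_iff_exists_fun' ℝ |>.1 hx
  refine Finset.sum_congr rfl fun i hi => ?_
  rw [inner_sum, Finset.sum_eq_single_of_mem i hi, real_inner_smul_right,
    mul_div_cancel_right₀ _ (hpos i hi).ne']
  intro j hj hji
  rw [real_inner_smul_right, h0 i hi j hj hji, mul_zero]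

variable [DecidableEq ι]

/-- The reflection exchanging u and w fixes every vector with equal inner products against both. It
therefore fixes I and the remaining edges and carries the foot I - u to the foot I - w. -/
theorem conicClass_eq_of_reflection {v : ι → EuclideanSpace ℝ (Fin n)} {s : Finset ι} {i j : ι}
    (hi : i ∈ s) (hj : j ∈ s) (hij : i ≠ j) {u w : EuclideanSpace ℝ (Fin n)}
    {I : EuclideanSpace ℝ (Fin n)} (hnorm : ‖u‖ = ‖w‖) (hI : inner ℝ u I = inner ℝ w I)
    (hv : ∀ l ∈ s, l ≠ i → l ≠ j → inner ℝ u (v l) = inner ℝ w (v l)) :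
    conicClass (Function.update (Function.update v i I) j (I - u)) s =
      conicClass (Function.update (Function.update v j I) i (I - w)) s := by
  set R := (ℝ ∙ (u - w))ᗮ.reflection with hR
  have hfix : ∀ x, inner ℝ u x = inner ℝ w x → R x = x := by
    intro x hx
    refine Submodule.reflection_mem_subspace_eq_self ?_
    rw [Submodule.mem_orthogonal_singleton_iff_inner_right, inner_sub_left, hx, sub_self]
  have hRu : R u = w := Submodule.reflection_sub hnorm
  set a := Function.update (Function.update v i I) j (I - u) with ha
  set b := Function.update (Function.update v j I) i (I - w) with hb
  have hai : a i = I := by simp [ha, hij]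
  have haj : a j = I - u := by simp [ha]
  have hbi : b i = I - w := by simp [hb]
  have hbj : b j = I := by simp [hb, hij.symm]
  have hRaj : R (a j) = b i := by rw [haj, hbi, map_sub, hfix I hI, hRu]
  have hRai : R (a i) = b j := by rw [hai, hbj, hfix I hI]
  have hl : ∀ l ∈ s, l ≠ i → l ≠ j → R (a l) = b l := by
    intro l hl hli hlj
    simp only [ha, hb, Function.update_of_ne hli, Function.update_of_ne hlj]
    exact hfix _ (hv l hl hli hlj)
  have himg : R '' conic a s = conic b s := by
    have h := image_conic R.toLinearEquiv.toLinearMap a s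
    refine Eq.trans h (Set.Subset.antisymm (conic_subset fun l hls => ?_)
      (conic_subset fun l hls => ?_))
    · change R (a l) ∈ _
      by_cases hli : l = i
      · rw [hli, hRai]; exact mem_conic_self hj
      by_cases hlj : l = j
      · rw [hlj, hRaj]; exact mem_conic_self hi
      rw [hl l hls hli hlj]; exact mem_conic_self hls
    · by_cases hli : l = i
      · rw [hli, ← hRaj]; exact mem_conic_self (v := R.toLinearEquiv.toLinearMap ∘ a) hj
      by_cases hlj : l = j
      · rw [hlj, ← hRai]; exact mem_conic_self (v := R.toLinearEquiv.toLinearMap ∘ a) hi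
      rw [← hl l hls hli hlj]; exact mem_conic_self (v := R.toLinearEquiv.toLinearMap ∘ a) hls
  have hcone : IsCone (R '' conic a s) := himg ▸ isCone_conic b s
  rw [conicClass, conicClass, ← coneClass_image R (isCone_conic a s) hcone]
  exact coneClass_congr himg _ _

/-- Modulo simplices of smaller dimension, the class of a simplex is divisible by two. -/
theorem conicClass_mem_of_two_smul_mem {e : ℕ} {v : ι → EuclideanSpace ℝ (Fin n)} {s : Finset ι}
    (hv : LinearIndepOn ℝ v (s : Set ι)) (hs : s.card = e + 1) (he : 1 ≤ e)
    {K : AddSubgroup (LGroup n)} (hK : simplexGroup n e ≤ K)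
    (h2 : ∀ y ∈ simplexGroup n (e + 1), 2 • y ∈ K) : conicClass v s ∈ K := by
  have hu : ∀ i ∈ s, ∃ u : EuclideanSpace ℝ (Fin n), ‖u‖ = 1 ∧
      (∀ j ∈ s, j ≠ i → inner ℝ u (v j) = 0) ∧ 0 < inner ℝ u (v i) ∧
        u ∈ Submodule.span ℝ (v '' (s : Set ι)) := fun i hi => exists_unit_normal hv hi
  choose! u hnorm horth hpos hspan using hu
  -- The incenter: it is at distance 1 from every facet hyperplane within the span of the simplex.
  set I := ∑ j ∈ s, (1 / inner ℝ (u j) (v j)) • v j with hIdef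
  have hI : ∀ i ∈ s, inner ℝ (u i) I = 1 := by
    intro i hi
    rw [hIdef, inner_sum, Finset.sum_eq_single_of_mem i hi, real_inner_smul_right,
      one_div_mul_cancel (hpos i hi).ne']
    intro j hj hji
    rw [real_inner_smul_right, horth i hi j hj hji, mul_zero]
  -- Distinct facets have distinct unit normals. Strictness puts the foot I - u i in the relative
  -- interior of facet i.
  have hlt : ∀ i ∈ s, ∀ j ∈ s, j ≠ i → inner ℝ (u j) (u i) < 1 := by
    intro i hi j hj hji
    refine lt_of_le_of_ne ?_ fun h => ?_
    · have := real_inner_le_norm (u j) (u i)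
      rwa [hnorm i hi, hnorm j hj, one_mul] at this
    · have := (inner_eq_one_iff_of_norm_eq_one (𝕜 := ℝ) (hnorm j hj) (hnorm i hi)).1 h
      have h1 := horth j hj i hi hji.symm
      rw [this] at h1
      exact (hpos i hi).ne' h1
  have hne : s.Nonempty := Finset.card_pos.1 (by omega)
  have hposI : ∀ i ∈ s, 0 < 1 / inner ℝ (u i) (v i) := fun i hi => one_div_pos.2 (hpos i hi)
  have hvi : ∀ i ∈ s, LinearIndepOn ℝ (Function.update v i I) (s : Set ι) := fun i hi =>
    linearIndepOn_update hv hi (hposI i hi).ne'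
  have hfirst : conicClass v s - ∑ i ∈ s, conicClass (Function.update v i I) s ∈ K := by
    have h := conicClass_sub_sum_update_mem hv hs.le (fun i hi => (hposI i hi).le)
      (hne.imp fun i hi => ⟨hi, hposI i hi⟩)
    rw [Finset.filter_true_of_mem hposI] at h
    exact hK h
  have hfoot : ∀ i ∈ s, ∑ j ∈ s, ((1 - inner ℝ (u j) (u i)) / inner ℝ (u j) (v j)) •
      Function.update v i I j = I - u i := by
    intro i hi
    have h1 : (1 - inner ℝ (u i) (u i)) / inner ℝ (u i) (v i) = 0 := by
      rw [real_inner_self_eq_norm_sq, hnorm i hi]; simp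
    have h2 : ∑ j ∈ s, ((1 - inner ℝ (u j) (u i)) / inner ℝ (u j) (v j)) •
        Function.update v i I j =
        ∑ j ∈ s, ((1 - inner ℝ (u j) (u i)) / inner ℝ (u j) (v j)) • v j := by
      refine Finset.sum_congr rfl fun j _ => ?_
      by_cases hji : j = i
      · rw [hji, h1, zero_smul, zero_smul]
      · rw [Function.update_of_ne hji]
    rw [h2]
    conv_rhs => rw [hIdef, ← sum_coords_eq horth hpos (hspan i hi)]
    rw [← Finset.sum_sub_distrib]
    exact Finset.sum_congr rfl fun j _ => by rw [← sub_smul, sub_div]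
  have hposF : ∀ i ∈ s, ∀ j ∈ s, j ≠ i →
      0 < (1 - inner ℝ (u j) (u i)) / inner ℝ (u j) (v j) := fun i hi j hj hji =>
    div_pos (sub_pos.2 (hlt i hi j hj hji)) (hpos j hj)
  have hzeroF : ∀ i ∈ s, (1 - inner ℝ (u i) (u i)) / inner ℝ (u i) (v i) = 0 := fun i hi => by
    rw [real_inner_self_eq_norm_sq, hnorm i hi]; simp
  set g : ι → ι → LGroup n := fun i j =>
    conicClass (Function.update (Function.update v i I) j (I - u i)) s with hg
  -- The foot has coefficient 0 on the edge I and positive coefficients on all other edges, so the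
  -- stellar subdivision at the foot keeps I and replaces each other edge once. A second edge exists
  -- because `1 ≤ e`.
  have hsecond : ∀ i ∈ s, conicClass (Function.update v i I) s - ∑ j ∈ s.erase i, g i j ∈ K := by
    intro i hi
    obtain ⟨j, hj, hji⟩ := Finset.exists_mem_ne (by omega : 1 < s.card) i
    have h := conicClass_sub_sum_update_mem (hvi i hi) hs.le
      (c := fun j => (1 - inner ℝ (u j) (u i)) / inner ℝ (u j) (v j)) (fun j hj => by
        by_cases hji : j = i
        · rw [hji, hzeroF i hi]
        · exact (hposF i hi j hj hji).le) ⟨j, hj, hposF i hi j hj hji⟩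
    have hfil : (s.filter fun j => 0 < (1 - inner ℝ (u j) (u i)) / inner ℝ (u j) (v j)) =
        s.erase i := by
      ext j
      rw [Finset.mem_filter, Finset.mem_erase, and_comm]
      refine and_congr_left fun hj => ⟨fun h hji => ?_, fun hji => hposF i hi j hj hji⟩
      rw [hji, hzeroF i hi] at h
      exact lt_irrefl _ h
    rw [hfil, hfoot i hi] at h
    exact hK h
  have hgmem : ∀ i ∈ s, ∀ j ∈ s.erase i, g i j ∈ simplexGroup n (e + 1) := by
    intro i hi j hj
    obtain ⟨hji, hjs⟩ := Finset.mem_erase.1 hj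
    refine conicClass_mem_simplexGroup ?_ hs.le
    rw [← hfoot i hi]
    exact linearIndepOn_update (hvi i hi) hjs
      (c := fun j => (1 - inner ℝ (u j) (u i)) / inner ℝ (u j) (v j)) (hposF i hi j hjs hji).ne'
  have hgsymm : ∀ i ∈ s, ∀ j ∈ s.erase i, g i j = g j i := by
    intro i hi j hj
    obtain ⟨hji, hjs⟩ := Finset.mem_erase.1 hj
    refine conicClass_eq_of_reflection hi hjs hji.symm ?_ ?_ ?_
    · rw [hnorm i hi, hnorm j hjs]
    · rw [hI i hi, hI j hjs]
    · intro l hl hli hlj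
      rw [horth i hi l hl hli, horth j hjs l hl hlj]
  have hsum : ∑ i ∈ s, ∑ j ∈ s.erase i, g i j ∈ K := by
    rw [← QuotientAddGroup.eq_zero_iff, Finset.sum_sigma']
    change QuotientAddGroup.mk' K _ = 0
    rw [map_sum]
    -- Swapping the indices pairs the pieces without fixed points; each pair sums to twice one
    -- class, which is zero modulo `K`.
    refine Finset.sum_involution (fun p _ => ⟨p.2, p.1⟩) ?_ ?_ ?_ ?_
    · rintro ⟨i, j⟩ hp
      obtain ⟨hi, hj⟩ := Finset.mem_sigma.1 hp
      simp only at hi hj ⊢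
      rw [← hgsymm i hi j hj, ← map_add, ← two_smul ℕ]
      exact (QuotientAddGroup.eq_zero_iff _).2 (h2 _ (hgmem i hi j hj))
    · rintro ⟨i, j⟩ hp _ h
      have hj := Finset.mem_erase.1 (Finset.mem_sigma.1 hp).2
      exact hj.1 (congrArg Sigma.fst h)
    · rintro ⟨i, j⟩ hp
      obtain ⟨hi, hj⟩ := Finset.mem_sigma.1 hp
      obtain ⟨hji, hjs⟩ := Finset.mem_erase.1 hj
      exact Finset.mem_sigma.2 ⟨hjs, Finset.mem_erase.2 ⟨hji.symm, hi⟩⟩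
    · rintro ⟨i, j⟩ _
      rfl
  have h3 := K.sum_mem hsecond
  rw [Finset.sum_sub_distrib] at h3
  have := K.add_mem hfirst (K.add_mem h3 hsum)
  simpa using this

end Incenter

/-! ### The quotient of `L_n` -/

section Quotient

variable {n : ℕ}

theorem conic_singleton_eq {E : Type*} [AddCommGroup E] [Module ℝ E] {ι : Type*} (v : ι → E)
    (i : ι) {r : ℝ} (hr : 0 < r) :
    conic v {i} = (PointedCone.hull ℝ {r • v i} : Set E) := by
  have h : conic (fun _ : Unit => r • v i) {()} = (PointedCone.hull ℝ {r • v i} : Set E) := by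
    simp [conic]
  rw [← h]
  refine Set.Subset.antisymm (conic_subset fun j hj => mem_conic.2 ⟨fun _ => r⁻¹, ?_, ?_⟩)
    (conic_subset fun j hj => mem_conic.2 ⟨fun _ => r, ?_, ?_⟩)
  · intro _ _; positivity
  · rw [Finset.mem_singleton.1 hj]
    simp [smul_smul, hr.ne']
  · intro _ _; positivity
  · simp

theorem conicClass_singleton_eq_halfLineClass (hn : 0 < n) {ι : Type*}
    {v : ι → EuclideanSpace ℝ (Fin n)} {i : ι} (hv : v i ≠ 0) :
    conicClass v {i} = halfLineClass n hn := by
  set e : EuclideanSpace ℝ (Fin n) :=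
    EuclideanSpace.single ⟨n - 1, Nat.sub_lt hn Nat.one_pos⟩ 1 with he
  have hnorm : 0 < ‖v i‖ := norm_pos_iff.2 hv
  set R := (ℝ ∙ (e - ‖v i‖⁻¹ • v i))ᗮ.reflection
  have hRe : R e = ‖v i‖⁻¹ • v i := Submodule.reflection_sub (by
    rw [norm_smul, norm_inv, norm_norm, inv_mul_cancel₀ hnorm.ne', he]
    simp)
  have himg : R '' (PointedCone.hull ℝ {e} : Set (EuclideanSpace ℝ (Fin n))) = conic v {i} := by
    rw [conic_singleton_eq v i (inv_pos.2 hnorm), ← hRe]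
    have h := image_conic R.toLinearEquiv.toLinearMap (fun _ : Unit => e) {()}
    simp only [conic, Finset.coe_singleton, Set.image_singleton] at h
    exact h
  have hcone := isCone_hull (E := EuclideanSpace ℝ (Fin n)) (Set.finite_singleton e)
  have hcone' : IsCone (R '' (PointedCone.hull ℝ {e} : Set (EuclideanSpace ℝ (Fin n)))) :=
    himg ▸ isCone_conic v {i}
  rw [conicClass, halfLineClass, ← coneClass_image R hcone hcone']
  exact coneClass_congr himg.symm _ _

/-- For d = 0 the multiplier 2 ^ d is 1, and there are no smaller simplices to correct by. -/
theorem simplexGroup_zero_le : simplexGroup n 0 ≤ Lev n ⊔ Lod n := by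
  rw [simplexGroup, AddSubgroup.closure_le]
  rintro _ ⟨ι, v, s, hv, hs, rfl⟩
  have h := two_pow_smul_conicClass_mem hv le_rfl fun e he => by omega
  rwa [Nat.le_zero.1 hs, pow_zero, one_smul] at h

theorem two_smul_halfLineClass_mem (hn : 0 < n) :
    2 • halfLineClass n hn ∈ Lev n ⊔ Lod n := by
  let v : Unit → EuclideanSpace ℝ (Fin n) := fun _ =>
    EuclideanSpace.single ⟨n - 1, Nat.sub_lt hn Nat.one_pos⟩ 1
  have hv0 : v () ≠ 0 := by simp [v]
  have hv : LinearIndepOn ℝ v (({()} : Finset Unit) : Set Unit) := by simpa using hv0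
  have h := two_pow_smul_conicClass_mem hv le_rfl fun e he => by
    rw [Finset.card_singleton] at he
    obtain rfl : e = 0 := by omega
    exact simplexGroup_zero_le
  rwa [Finset.card_singleton, pow_one, conicClass_singleton_eq_halfLineClass hn hv0] at h

theorem parityHom_halfLineClass (hn : 0 < n) : parityHom n (halfLineClass n hn) = 1 := by
  let v : Unit → EuclideanSpace ℝ (Fin n) := fun _ =>
    EuclideanSpace.single ⟨n - 1, Nat.sub_lt hn Nat.one_pos⟩ 1
  have hv0 : v () ≠ 0 := by simp [v]
  rw [← conicClass_singleton_eq_halfLineClass hn hv0]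
  exact parityHom_conicClass_of_card_eq_one hv0

theorem sup_le_ker_parityHom : Lev n ⊔ Lod n ≤ (parityHom n).ker := by
  refine sup_le ((AddSubgroup.closure_le _).2 ?_) ((AddSubgroup.closure_le _).2 ?_) <;>
  · rintro _ ⟨C, m, _, hC, rfl⟩
    exact parityHom_toL_eq_zero C hC

/-- From dimension 2 on, the group of simplices modulo `H` is 2-divisible by the incenter dissection
and killed by a power of 2 by the cross-polytope cones, so it vanishes. Dimension 1 is where d
enters. -/
theorem simplexGroup_le (hn : 0 < n) (d : ℕ) :
    simplexGroup n d ≤ Lev n ⊔ Lod n ⊔ AddSubgroup.zmultiples (halfLineClass n hn) := by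
  classical
  set H := Lev n ⊔ Lod n ⊔ AddSubgroup.zmultiples (halfLineClass n hn)
  induction d using Nat.strong_induction_on with
  | _ d ih =>
  rcases d with _ | e
  · exact simplexGroup_zero_le.trans le_sup_left
  have hK : ∀ k, k + 1 ≤ e + 1 → simplexGroup n k ≤ H := fun k hk => ih k (by omega)
  have hlow : ∀ {ι : Type} {v : ι → EuclideanSpace ℝ (Fin n)} {s : Finset ι},
      LinearIndepOn ℝ v (s : Set ι) → s.card ≤ e → conicClass v s ∈ H := fun hv hs =>
    hK e le_rfl (conicClass_mem_simplexGroup hv hs)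
  rcases e with _ | e
  · rw [simplexGroup, AddSubgroup.closure_le]
    rintro _ ⟨ι, v, s, hv, hs, rfl⟩
    rcases hs.lt_or_eq with h | h
    · exact hlow hv (by omega)
    · obtain ⟨i, rfl⟩ := Finset.card_eq_one.1 h
      have hv0 : v i ≠ 0 := by simpa using hv
      rw [conicClass_singleton_eq_halfLineClass hn hv0]
      exact AddSubgroup.mem_sup_right (AddSubgroup.mem_zmultiples _)
  set B := simplexGroup n (e + 1 + 1) with hB
  have hpow : ∀ x ∈ B, 2 ^ (e + 2) • x ∈ H := by
    have : B ≤ H.comap (nsmulAddMonoidHom (2 ^ (e + 2))) := by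
      rw [hB, simplexGroup, AddSubgroup.closure_le]
      rintro _ ⟨ι, v, s, hv, hs, rfl⟩
      change 2 ^ (e + 2) • conicClass v s ∈ H
      rcases hs.lt_or_eq with h | h
      · exact H.nsmul_mem (hlow hv (by omega)) _
      · rw [← h]
        exact two_pow_smul_conicClass_mem hv le_sup_left fun k hk => hK k (by omega)
    exact this
  have hdiv : B ≤ H ⊔ B.map (nsmulAddMonoidHom 2) := by
    conv_lhs => rw [hB, simplexGroup]
    rw [AddSubgroup.closure_le]
    rintro _ ⟨ι, v, s, hv, hs, rfl⟩
    rcases hs.lt_or_eq with h | h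
    · exact AddSubgroup.mem_sup_left (hlow hv (by omega))
    · exact conicClass_mem_of_two_smul_mem hv h (by omega)
        ((hK (e + 1) le_rfl).trans le_sup_left)
        fun y hy => AddSubgroup.mem_sup_right ⟨y, hy, rfl⟩
  -- Iterating the divisibility by two makes x divisible by 2^k modulo `H`; k = e + 2 is the
  -- exponent that `hpow` kills.
  have hiter : ∀ k, ∀ x ∈ B, ∃ y ∈ B, x - 2 ^ k • y ∈ H := by
    intro k
    induction k with
    | zero => exact fun x hx => ⟨x, hx, by simp⟩
    | succ k ihk =>
      intro x hx
      obtain ⟨y, hy, hxy⟩ := ihk x hx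
      obtain ⟨h, hh, _, ⟨z, hz, rfl⟩, hyz⟩ := AddSubgroup.mem_sup.1 (hdiv hy)
      refine ⟨z, hz, ?_⟩
      have h1 : y - 2 • z = h := by
        rw [← hyz]
        simp
      have : x - 2 ^ (k + 1) • z = (x - 2 ^ k • y) + 2 ^ k • (y - 2 • z) := by
        rw [nsmul_sub, smul_smul, ← pow_succ]
        abel
      rw [this, h1]
      exact H.add_mem hxy (H.nsmul_mem hh _)
  intro x hx
  obtain ⟨y, hy, hxy⟩ := hiter (e + 2) x hx
  simpa using H.add_mem hxy (hpow y hy)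

theorem sup_zmultiples_halfLineClass_eq_top (hn : 0 < n) :
    Lev n ⊔ Lod n ⊔ AddSubgroup.zmultiples (halfLineClass n hn) = ⊤ := by
  rw [eq_top_iff]
  rintro x -
  obtain ⟨y, rfl⟩ := QuotientAddGroup.mk_surjective x
  induction y using FreeAbelianGroup.induction_on with
  | zero => exact zero_mem _
  | of P =>
    obtain ⟨e, he⟩ := exists_coneClass_mem_simplexGroup P.2
    exact simplexGroup_le hn e he
  | neg P h => exact neg_mem h
  | add x y hx hy => exact add_mem hx hy

end Quotient

theorem propositionM (n : ℕ) (hn : 0 < n) :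
    (Lev n ⊔ Lod n).index = 2 ∧
      AddSubgroup.zmultiples
        (QuotientAddGroup.mk (halfLineClass n hn) : LGroup n ⧸ (Lev n ⊔ Lod n)) = ⊤ := by
  set M := Lev n ⊔ Lod n with hM
  have htop : AddSubgroup.zmultiples
      (QuotientAddGroup.mk (halfLineClass n hn) : LGroup n ⧸ M) = ⊤ := by
    rw [eq_top_iff]
    rintro q -
    obtain ⟨x, rfl⟩ := QuotientAddGroup.mk_surjective q
    have hx : x ∈ M ⊔ AddSubgroup.zmultiples (halfLineClass n hn) := by
      rw [sup_zmultiples_halfLineClass_eq_top hn]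
      trivial
    obtain ⟨m, hm, _, ⟨k, rfl⟩, rfl⟩ := AddSubgroup.mem_sup.1 hx
    refine ⟨k, ?_⟩
    have h0 : (QuotientAddGroup.mk m : LGroup n ⧸ M) = 0 := (QuotientAddGroup.eq_zero_iff m).2 hm
    rw [QuotientAddGroup.mk_add, h0, zero_add]
    rfl
  refine ⟨?_, htop⟩
  -- Twice the half-line is, modulo the point class, a one-dimensional cross-polytope cone, while
  -- its parity 1 keeps the half-line itself outside M.
  have hord : addOrderOf (QuotientAddGroup.mk (halfLineClass n hn) : LGroup n ⧸ M) = 2 := by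
    refine addOrderOf_eq_prime ?_ fun h => ?_
    · exact (QuotientAddGroup.eq_zero_iff _).2 (two_smul_halfLineClass_mem hn)
    · have := sup_le_ker_parityHom ((QuotientAddGroup.eq_zero_iff _).1 h)
      rw [AddMonoidHom.mem_ker, parityHom_halfLineClass hn] at this
      exact one_ne_zero this
  rw [AddSubgroup.index, ← hord, ← Nat.card_zmultiples, htop]
  exact (Nat.card_congr AddSubgroup.topEquiv.toEquiv).symm
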